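/- Let $m\ge 0$ be an integer, let $B\subset\mathbb R^3$ be a bounded domain and let $\gamma\subset\mathbb R^3$ be a curve. **Notation.** A unit vector $\xi=(\sin\varphi_1\sin\varphi_2,\ \sin\varphi_1\cos\varphi_2,\ \cos\varphi_1)$ is completed to an orthonormal frame by $\xi_\alpha=(\cos\varphi_1\sin\varphi_2,\ \cos\varphi_1\cos\varphi_2,\ -\sin\varphi_1)$ and $\xi_\beta=(\cos\varphi_2,\ -\sin\varphi_2,\ 0)$ (with $\varphi_2=0$ if $\sin\varphi_1=0$). For a smooth symmetric $m$-tensor field $f$ on $\mathbb R^3$ that vanishes outside $B$, a unit vector $\xi$, a point $x\perp\xi$, and $0\le i\le m$, the transverse ray transforms are $$\mathcal T_if(x,\xi)=\int_{\mathbb R}\big\langle f(x+t\xi),\ \xi_\alpha^{\odot i}\odot\xi_\beta^{\odot(m-i)}\big\rangle\,dt ,$$ where $\odot$ is the symmetrized tensor product. **Assumptions.** 1. $\gamma$ encompasses $B$: $\gamma\cap B=\emptyset$, and for all $a\in\gamma$ and $\xi\ne0$ at most one of the rays $\{a+t\xi:t\ge0\}$ and $\{a+t\xi:t\le0\}$ intersects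 $B$. 2. $\gamma$ satisfies the Kirillov–Tuy condition of order $m$ with respect to $B$: for almost every $(\omega,p)\in\mathbb S^2\times\mathbb R$ whose plane $H_{\omega,p}=\{x:\langle\omega,x\rangle=p\}$ intersects $B$, there are points $\gamma_1,\dots,\gamma_{m+1}\in H_{\omega,p}\cap\gamma$, depending locally smoothly on $(\omega,p)$, such that for almost every $x\in H_{\omega,p}\cap B$ the vectors $x-\gamma_1,\dots,x-\gamma_{m+1}$ are generic, i.e. every symmetric $m$-tensor $T$ on the two-dimensional space $\omega^\perp$ is uniquely determined by the values $\langle T,(x-\gamma_j)^{\odot m}\rangle$, $1\le j\le m+1$. **Conclusion.** A smooth symmetric $m$-tensor field $f$ vanishing outside $B$ is uniquely determined by, and can be reconstructed from, the functions $\mathcal T_0f,\dots,\mathcal T_mf$ on the lines $\{x+t\xi : t\in\mathbb R\}$ that intersect $\gamma$. That is: if two such fields $f,g$ satisfy $\mathcal T_if(x,\xi)=\mathcal T_ig(x,\xi)$ for all $0\le i\le m$ and all lines intersecting $\gamma$, then $f=g$; and there is a linear operator $\mathcal R$, depending only on $m$, $B$ and $\gamma$, that maps the restricted data $(\mathcal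 T_if)_{0\le i\le m}$ of every such $f$ to $f$. -/

import Mathlib

open MeasureTheory Metric
open scoped ContDiff RealInnerProductSpace

noncomputable section

/-- Euclidean space `ℝⁿ`. -/
abbrev Euc (n : ℕ) := EuclideanSpace ℝ (Fin n)

/-- Covariant tensors of order `m` on `V`, as `m`-linear forms. -/
abbrev Tensor (m : ℕ) (V : Type*) [NormedAddCommGroup V] [NormedSpace ℝ V] :=
  ContinuousMultilinearMap ℝ (fun _ : Fin m => V) ℝ

/-- The tensor `T` is symmetric: its value does not change when its arguments are permuted. -/
def IsSymmTensor {m : ℕ} {V : Type*} [NormedAddCommGroup V] [NormedSpace ℝ V]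
    (T : Tensor m V) : Prop :=
  ∀ (σ : Equiv.Perm (Fin m)) (v : Fin m → V), T (fun k => v (σ k)) = T v

/-- The pairing `⟨T, v₁ ⊙ ⋯ ⊙ v_m⟩` of a tensor with the symmetrized tensor product
`v₁ ⊙ ⋯ ⊙ v_m = (1 / m!) ∑_π v_{π 1} ⊗ ⋯ ⊗ v_{π m}`. -/
def symPairing {m : ℕ} {V : Type*} [NormedAddCommGroup V] [NormedSpace ℝ V]
    (T : Tensor m V) (v : Fin m → V) : ℝ :=
  ((m.factorial : ℝ))⁻¹ * ∑ π : Equiv.Perm (Fin m), T (fun k => v (π k))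

/-- A smooth symmetric `m`-tensor field on `ℝⁿ` that is supported in `B`. -/
structure IsSymmTensorFieldIn (m n : ℕ) (B : Set (Euc n)) (f : Euc n → Tensor m (Euc n)) :
    Prop where
  symm : ∀ x, IsSymmTensor (f x)
  smooth : ContDiff ℝ ∞ f
  supp : ∀ x, x ∉ B → f x = 0

/-! ### The frame of spherical coordinates and the transverse ray transform in `ℝ³` -/

/-- The polar angle `φ₁ ∈ [0, π]` of a unit vector
`ξ = (sin φ₁ sin φ₂, sin φ₁ cos φ₂, cos φ₁)`. -/
def polarAngle (ξ : Euc 3) : ℝ := Real.arccos (ξ 2)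

/-- The azimuth `φ₂` of a unit vector `ξ = (sin φ₁ sin φ₂, sin φ₁ cos φ₂, cos φ₁)`; only its
sine and cosine are used, so that it matters modulo `2π` only. At the two poles, where every
`φ₂` is admissible, it is `0`. -/
def azimuth (ξ : Euc 3) : ℝ := Complex.arg ⟨ξ 1, ξ 0⟩

/-- The vector `ξ_α = (cos φ₁ sin φ₂, cos φ₁ cos φ₂, - sin φ₁)`. -/
def xiAlpha (ξ : Euc 3) : Euc 3 :=
  !₂[Real.cos (polarAngle ξ) * Real.sin (azimuth ξ),
     Real.cos (polarAngle ξ) * Real.cos (azimuth ξ),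
     -Real.sin (polarAngle ξ)]

/-- The vector `ξ_β = (cos φ₂, - sin φ₂, 0)`. -/
def xiBeta (ξ : Euc 3) : Euc 3 :=
  !₂[Real.cos (azimuth ξ), -Real.sin (azimuth ξ), 0]

/-- The transverse ray transform
`T_i f (x, ξ) = ∫_ℝ ⟨f (x + t ξ), ξ_α^{⊙ i} ⊙ ξ_β^{⊙ (m - i)}⟩ dt`, for `0 ≤ i ≤ m`. -/
def transverseRay {m : ℕ} (f : Euc 3 → Tensor m (Euc 3)) (i : Fin (m + 1)) (x ξ : Euc 3) : ℝ :=
  ∫ t : ℝ, symPairing (f (x + t • ξ))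
    (fun k : Fin m => if (k : ℕ) < (i : ℕ) then xiAlpha ξ else xiBeta ξ)

/-- The (oriented) lines `{x + t ξ : t ∈ ℝ}` in `ℝ³`, `|ξ| = 1`, `⟨x, ξ⟩ = 0`,
that intersect `γ`. -/
abbrev LineThrough (γ : Set (Euc 3)) :=
  {l : Euc 3 × Euc 3 // ‖l.2‖ = 1 ∧ ⟪l.1, l.2⟫ = 0 ∧ ∃ t : ℝ, l.1 + t • l.2 ∈ γ}

/-- The restricted data: all `T_i f`, `0 ≤ i ≤ m`, on all lines that intersect `γ`. -/
def restrictedTransverseRay {m : ℕ} (γ : Set (Euc 3)) (f : Euc 3 → Tensor m (Euc 3)) :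
    LineThrough γ → Fin (m + 1) → ℝ :=
  fun l i => transverseRay f i l.1.1 l.1.2

/-! ### The conditions on the curve -/

/-- The hyperplane `H_{w,p} = {x : ⟨w, x⟩ = p}`. -/
def hyperplane {n : ℕ} (w : Euc n) (p : ℝ) : Set (Euc n) := {x | ⟪w, x⟫ = p}

/-- `ν(m, n) = binom (m + n - 2) m`, the dimension of the space of symmetric `m`-tensors on
an `(n - 1)`-dimensional space. -/
def nu (m n : ℕ) : ℕ := (m + n - 2).choose m

/-- The vectors `e_j` are generic (of order `m`) in `V`: a symmetric `m`-tensor `T` on `V` is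
uniquely determined by the values `⟨T, e_j^{⊙ m}⟩`. -/
def IsGeneric (m : ℕ) {V : Type*} [NormedAddCommGroup V] [NormedSpace ℝ V] {ι : Type*}
    (e : ι → V) : Prop :=
  ∀ S T : Tensor m V, IsSymmTensor S → IsSymmTensor T →
    (∀ j, S (fun _ => e j) = T (fun _ => e j)) → S = T

/-- The Kirillov-Tuy condition of order `m`. For almost every `(w, p) ∈ S^{n-1} × ℝ` whose
hyperplane meets `B` there are points `g_1, …, g_ν ∈ H_{w,p} ∩ γ`, the values at `(w, p)` of
functions that are smooth near `(w, p)` and select points of `H_{w',p'} ∩ γ` for all unit `w'`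
and all `p'` near `(w, p)` (smoothness on the sphere is smoothness of an extension to the ambient
space), such that for almost every `x = p w + v`, `v ∈ w^⊥`, of `H_{w,p} ∩ B` the vectors
`x - g_j` are generic in the `(n - 1)`-dimensional space `w^⊥`. -/
def KirillovTuy (m n : ℕ) (B γ : Set (Euc n)) : Prop :=
  ∀ᵐ q : sphere (0 : Euc n) 1 × ℝ ∂((volume : Measure (Euc n)).toSphere.prod volume),
    (hyperplane (q.1 : Euc n) q.2 ∩ B).Nonempty →
    ∃ (U : Set (Euc n × ℝ)) (g : Fin (nu m n) → Euc n × ℝ → Euc n),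
      IsOpen U ∧ ((q.1 : Euc n), q.2) ∈ U ∧
      (∀ j, ContDiffOn ℝ ∞ (g j) U) ∧
      (∀ j, ∀ r ∈ U, ‖r.1‖ = 1 → g j r ∈ hyperplane r.1 r.2 ∩ γ) ∧
      ∀ᵐ v : (Submodule.span ℝ {(q.1 : Euc n)})ᗮ,
        q.2 • (q.1 : Euc n) + (v : Euc n) ∈ B →
        ∃ e : Fin (nu m n) → (Submodule.span ℝ {(q.1 : Euc n)})ᗮ,
          (∀ j, (e j : Euc n) =
            q.2 • (q.1 : Euc n) + (v : Euc n) - g j ((q.1 : Euc n), q.2)) ∧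
          IsGeneric m e

/-- `γ` encompasses `B`: it does not meet `B`, and for `a ∈ γ` and `ξ ≠ 0` at most one of the
two rays from `a` in the directions `ξ` and `-ξ` meets `B`. -/
def Encompasses {n : ℕ} (γ B : Set (Euc n)) : Prop :=
  γ ∩ B = ∅ ∧ ∀ a ∈ γ, ∀ ξ : Euc n, ξ ≠ 0 →
    ¬ ((∃ t : ℝ, 0 ≤ t ∧ a + t • ξ ∈ B) ∧ (∃ t : ℝ, t ≤ 0 ∧ a + t • ξ ∈ B))

end

/-!
The data determine `f` linearly, so both claims follow once a field `f` with vanishing data is known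
to vanish: the reconstruction is then a linear left inverse of the transform.

Since `ξ_α, ξ_β` span `ξ^⊥` and `γ` encompasses `B`, vanishing data mean that
`∫_{t > 0} ⟨f (a + t ξ), η^m⟩ dt = 0` for all `a ∈ γ` and all `η ⊥ ξ ≠ 0`
(`integral_halfLine_eq_zero`). Fix a unit vector `w` and `c ⊥ w`. For `θ ⊥ w` the vector
`η = ⟨c, θ⟩ w - s c` is transverse to `ξ = θ + s w`. The derivative of order `m + 1` at `s = 0` of the
relation for these `ξ, η` carries exactly the powers of `t` that turn its integral over all
directions `θ` of the plane `a + w^⊥` into an integral with respect to area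
(`integral_plane_source`):
`∑ i, A_i ∫ ⟨c, x - a⟩^(m - i) ⟨∂_w^(m + 1 - i) f x, c^i w^(m - i)⟩ dx = 0`.

The left side is a polynomial of degree `m` in `⟨c, a⟩`. By the Kirillov–Tuy condition almost every
plane that meets `B` contains `m + 1` different points `a` of `γ`
(`KirillovTuy.ae_exists_injective`): if two of the points coincided, a product of `m` linear forms
would vanish on all vectors that are required to be generic (`IsGeneric.injective`). So all
coefficients of this polynomial vanish, for generic `c` and then for all `c`
(`integral_momentIntegrand_eq_zero`). Multiplication with `e^(σ p)`, where `p` is the signed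
distance of the plane from the origin, integration over `p` and integration by parts
give linear relations, for `c ⊥ ζ`, between the moments
`Y(a, b) = ∫ ⟨c, x⟩^a e^⟨ζ, x⟩ ⟨f x, c^b ζ^(m - b)⟩ dx` with `a + b = l ≤ m`
(`sum_expCoeff_mul_expMoment`).

The derivative of `Y(a, b)` in `ζ` along `c` is `Y(a + 1, b) + (m - b) Y(a, b + 1)`. If all moments
of order `l - 1` vanish, those of order `l` are therefore multiples of `Y(0, l)`, and the relation
becomes a nonzero multiple (`sum_expCoeff_ne_zero`) of `Y(0, l) = 0`. By induction all moments up to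
order `m` vanish (`expMoment_eq_zero`). The moment `Y(0, m)` is the Laplace transform of
`⟨f x, c^m⟩`, so that `f = 0`.
-/

/-! ### Symmetric tensors evaluated on two vectors -/

section SymmetricTensors

variable {V : Type*} {m : ℕ}

/-- The argument tuple `(v, …, v, w, …, w)` of length `m` that starts with `i` copies of `v`. -/
def mixArg (m i : ℕ) (v w : V) : Fin m → V := fun k => if (k : ℕ) < i then v else w

lemma mixArg_of_le {i : ℕ} (hi : m ≤ i) (v w : V) : mixArg m i v w = fun _ => v := by
  funext k; simp [mixArg, k.2.trans_le hi]

variable [NormedAddCommGroup V] [NormedSpace ℝ V]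

lemma symPairing_of_isSymmTensor {T : Tensor m V} (hT : IsSymmTensor T) (v : Fin m → V) :
    symPairing T v = T v := by
  have h : ∑ π : Equiv.Perm (Fin m), T (fun k => v (π k)) = (m.factorial : ℝ) * T v := by
    rw [Finset.sum_congr rfl fun π _ => hT π v]
    simp [Fintype.card_perm]
  rw [symPairing, h, inv_mul_cancel_left₀ (by positivity)]

/-- A symmetric tensor sees of a tuple with entries in `{v, w}` only the number of `v`s. -/
lemma IsSymmTensor.apply_ite {T : Tensor m V} (hT : IsSymmTensor T) (s : Finset (Fin m))
    (v w : V) : T (fun k => if k ∈ s then v else w) = T (mixArg m s.card v w) := by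
  classical
  have hs : s.card ≤ m := by simpa using s.card_le_univ
  have hcard : Fintype.card {k : Fin m // (k : ℕ) < s.card} = Fintype.card {k // k ∈ s} := by
    rw [Fintype.card_coe, Fintype.card_subtype]
    rw [show (Finset.univ.filter fun k : Fin m => (k : ℕ) < s.card)
      = (Finset.univ : Finset (Fin s.card)).map (Fin.castLEEmb hs) by
        ext k
        simp only [Finset.mem_filter, Finset.mem_univ, true_and, Finset.mem_map,
          Fin.castLEEmb_apply]
        exact ⟨fun h => ⟨⟨k, h⟩, rfl⟩, by rintro ⟨j, rfl⟩; exact j.2⟩]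
    simp
  let e := Fintype.equivOfCardEq hcard
  rw [← hT e.extendSubtype]
  congr 1
  funext k
  by_cases hk : (k : ℕ) < s.card
  · simp [mixArg, hk, e.extendSubtype_mem k hk]
  · simp [mixArg, hk, e.extendSubtype_not_mem k hk]

/-- Binomial expansion of `T ((u v + w z)^m)` for a symmetric tensor `T`. -/
lemma IsSymmTensor.apply_add {T : Tensor m V} (hT : IsSymmTensor T) (u w : ℝ) (v z : V) :
    T (fun _ => u • v + w • z) =
      ∑ i ∈ Finset.range (m + 1), (m.choose i : ℝ) * (u ^ i * w ^ (m - i) * T (mixArg m i v z)) := by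
  classical
  have h1 : T (fun _ => u • v + w • z)
      = ∑ s : Finset (Fin m), T (s.piecewise (fun _ => u • v) (fun _ => w • z)) :=
    T.map_add_univ (fun _ => u • v) (fun _ => w • z)
  have h2 : ∀ s : Finset (Fin m), T (s.piecewise (fun _ => u • v) (fun _ => w • z))
      = u ^ s.card * w ^ (m - s.card) * T (mixArg m s.card v z) := by
    intro s
    have h3 : s.piecewise (fun _ => u • v) (fun _ => w • z)
        = fun k => (if k ∈ s then u else w) • (if k ∈ s then v else z) := by
      funext k
      by_cases hk : k ∈ s <;> simp [hk]
    rw [h3, T.map_smul_univ, hT.apply_ite, Finset.prod_ite]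
    simp [Finset.filter_not, Finset.card_sdiff]
  rw [h1, Finset.sum_congr rfl fun s _ => h2 s]
  have h4 := Finset.sum_powerset_apply_card
    (fun i => u ^ i * w ^ (m - i) * T (mixArg m i v z)) (x := (Finset.univ : Finset (Fin m)))
  simpa [nsmul_eq_mul] using h4

lemma mixArg_smul_right (T : Tensor m V) {i : ℕ} (hi : i ≤ m) (r : ℝ) (v w : V) :
    T (mixArg m i v (r • w)) = r ^ (m - i) * T (mixArg m i v w) := by
  have h : mixArg m i v (r • w)
      = fun k : Fin m => (if (k : ℕ) < i then (1 : ℝ) else r) • mixArg m i v w k := by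
    funext k
    by_cases hk : (k : ℕ) < i <;> simp [mixArg, hk]
  rw [h, T.map_smul_univ, Fin.prod_univ_eq_prod_range (fun k => if k < i then (1 : ℝ) else r) m,
    ← Finset.prod_range_mul_prod_Ico _ hi]
  rw [Finset.prod_eq_one fun k hk => by simp [Finset.mem_range.1 hk],
    Finset.prod_congr rfl fun k hk => if_neg (not_lt.2 (Finset.mem_Ico.1 hk).1)]
  simp

/-- Derivative of `T (v^i z^(m-i))` in `z` along `v`: it is `(m - i) T (v^(i+1) z^(m-i-1))`. -/
lemma IsSymmTensor.hasDerivAt_mixArg {T : Tensor m V} (hT : IsSymmTensor T) {i : ℕ} (hi : i ≤ m)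
    (v z : V) (s : ℝ) :
    HasDerivAt (fun s : ℝ => T (mixArg m i v (z + s • v)))
      ((m - i : ℕ) * T (mixArg m (i + 1) v (z + s • v))) s := by
  classical
  set y : Fin m → V := fun k => if (k : ℕ) < i then 0 else v with hy
  have hcurve : HasDerivAt (fun s : ℝ => mixArg m i v (z + s • v)) y s := by
    rw [hasDerivAt_pi]
    intro k
    by_cases hk : (k : ℕ) < i
    · simpa [mixArg, hy, hk] using hasDerivAt_const s v
    · simpa [mixArg, hy, hk] using ((hasDerivAt_id s).smul_const v).const_add z
  have h := (T.hasFDerivAt (mixArg m i v (z + s • v))).comp_hasDerivAt s hcurve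
  refine h.congr_deriv ?_
  rw [ContinuousMultilinearMap.linearDeriv_apply]
  have hterm : ∀ k : Fin m, T (Function.update (mixArg m i v (z + s • v)) k (y k))
      = if (k : ℕ) < i then 0 else T (mixArg m (i + 1) v (z + s • v)) := by
    intro k
    by_cases hk : (k : ℕ) < i
    · rw [if_pos hk]
      exact T.map_coord_zero k (by simp [hy, hk])
    · have hs : Function.update (mixArg m i v (z + s • v)) k (y k)
          = fun j => if j ∈ insert k (Finset.univ.filter fun j : Fin m => (j : ℕ) < i)
            then v else z + s • v := by
        funext j
        by_cases hjk : j = k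
        · subst hjk; simp [hy, hk]
        · simp [hjk, mixArg]
      have hc : (Finset.univ.filter fun j : Fin m => (j : ℕ) < i).card = i := by
        rw [Fin.card_filter_val_lt, min_eq_right hi]
      rw [hs, hT.apply_ite, Finset.card_insert_of_notMem (by simp [hk]), hc, if_neg hk]
  rw [Finset.sum_congr rfl fun k _ => hterm k, Finset.sum_ite]
  have hc : (Finset.univ.filter fun j : Fin m => ¬ (j : ℕ) < i).card = m - i := by
    rw [Finset.filter_not, Finset.card_sdiff_of_subset (Finset.filter_subset _ _),
      Fin.card_filter_val_lt, min_eq_right hi]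
    simp
  rw [Finset.sum_const_zero, zero_add, Finset.sum_const, hc, nsmul_eq_mul]

/-- A symmetric tensor is determined by its values on the diagonal. -/
lemma IsSymmTensor.eq_zero_of_diagonal {T : Tensor m V} (hT : IsSymmTensor T)
    (h : ∀ v : V, T (fun _ => v) = 0) : T = 0 := by
  ext v
  have h1 := T.iteratedFDeriv_comp_diagonal 0 v
  have h2 : (fun x : V => T (fun _ => x)) = fun _ => 0 := funext h
  rw [h2, Finset.sum_congr rfl fun σ _ => hT σ v] at h1
  have h3 : ((m.factorial : ℝ)) * T v = 0 := by
    simpa [Fintype.card_perm] using h1.symm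
  simpa [m.factorial_ne_zero] using h3

/-- Vectors of a plane that determine symmetric `m`-tensors are pairwise distinct if there are
`m + 1` of them: otherwise the symmetrized product of `m` linear forms, each of which vanishes on
one of the vectors, vanishes on all of them. -/
lemma IsGeneric.injective [FiniteDimensional ℝ V] (hV : 1 < Module.finrank ℝ V)
    {e : Fin (m + 1) → V} (he : IsGeneric m e) : Function.Injective e := by
  classical
  intro i₀ i₁ h01
  by_contra hne
  have hform : ∀ j, ∃ n : V →L[ℝ] ℝ, n ≠ 0 ∧ n (e j) = 0 := by
    intro j
    have hlt : Submodule.span ℝ {e j} < ⊤ := by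
      refine lt_top_iff_ne_top.2 fun htop => ?_
      have := finrank_span_le_card (R := ℝ) ({e j} : Set V)
      rw [htop, finrank_top, Set.toFinset_singleton, Finset.card_singleton] at this
      omega
    obtain ⟨n, hn0, hn⟩ := Submodule.exists_le_ker_of_lt_top _ hlt
    refine ⟨LinearMap.toContinuousLinearMap n, by simpa using hn0, ?_⟩
    exact hn (Submodule.mem_span_singleton_self _)
  choose n hn0 hn using hform
  let N : Fin m → V →L[ℝ] ℝ := fun k => n (i₀.succAbove k)
  let T : Tensor m V := ∑ π : Equiv.Perm (Fin m),
    (ContinuousMultilinearMap.mkPiAlgebra ℝ (Fin m) ℝ).compContinuousLinearMap fun k => N (π k)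
  have hTapp : ∀ v, T v = ∑ π : Equiv.Perm (Fin m), ∏ k, N (π k) (v k) := by
    intro v; simp [T]
  have hTdiag : ∀ v : V, T (fun _ => v) = (m.factorial : ℝ) * ∏ k, N k v := by
    intro v
    rw [hTapp, Finset.sum_congr rfl fun π _ => Equiv.prod_comp π (fun k => N k v)]
    simp [Fintype.card_perm]
  have hTsymm : IsSymmTensor T := by
    intro σ v
    rw [hTapp, hTapp, ← Equiv.sum_comp (Equiv.mulRight σ)]
    refine Finset.sum_congr rfl fun π _ => ?_
    exact Equiv.prod_comp σ fun k => N (π k) (v k)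
  have hT0 : T = 0 := by
    refine he T 0 hTsymm (fun _ _ => rfl) fun j => ?_
    have : ∃ k, N k (e j) = 0 := by
      by_cases hj : j = i₀
      · obtain ⟨k, hk⟩ := Fin.exists_succAbove_eq (Ne.symm hne)
        exact ⟨k, by rw [hj, h01]; simp only [N, hk]; exact hn i₁⟩
      · obtain ⟨k, hk⟩ := Fin.exists_succAbove_eq hj
        exact ⟨k, by simp only [N, hk]; exact hn j⟩
    obtain ⟨k, hk⟩ := this
    rw [hTdiag, Finset.prod_eq_zero (Finset.mem_univ k) hk]
    simp
  have hcover : ⋃ k, (((N k).ker : Submodule ℝ V) : Set V) = Set.univ := by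
    refine Set.eq_univ_of_forall fun v => ?_
    have h := hTdiag v
    rw [hT0] at h
    have h' : ∏ k, N k v = 0 := by
      simpa [m.factorial_ne_zero] using h.symm
    obtain ⟨k, -, hk⟩ := Finset.prod_eq_zero_iff.1 h'
    exact Set.mem_iUnion.2 ⟨k, hk⟩
  obtain ⟨k, hk⟩ := Subspace.exists_eq_top_of_iUnion_eq_univ hcover
  refine hn0 (i₀.succAbove k) ?_
  ext v
  have : v ∈ (N k).ker := hk ▸ Submodule.mem_top
  exact this

end SymmetricTensors

/-! ### From the transverse ray transform to integrals over half-lines -/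

section Frame

lemma inner_euc_three (x y : Euc 3) : ⟪x, y⟫ = x 0 * y 0 + x 1 * y 1 + x 2 * y 2 := by
  simp [PiLp.inner_apply, Fin.sum_univ_three, mul_comm]

/-- The vectors `ξ_α`, `ξ_β` span the orthogonal complement of the unit vector `ξ`. -/
lemma exists_eq_xiAlpha_add_xiBeta {ξ η : Euc 3} (hξ : ‖ξ‖ = 1) (h : ⟪η, ξ⟫ = 0) :
    ∃ u w : ℝ, η = u • xiAlpha ξ + w • xiBeta ξ := by
  have hn : ξ 0 ^ 2 + ξ 1 ^ 2 + ξ 2 ^ 2 = 1 := by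
    have := real_inner_self_eq_norm_sq ξ
    rw [inner_euc_three, hξ] at this
    linarith
  have hcos : Real.cos (polarAngle ξ) = ξ 2 :=
    Real.cos_arccos (by nlinarith [sq_nonneg (ξ 0), sq_nonneg (ξ 1)])
      (by nlinarith [sq_nonneg (ξ 0), sq_nonneg (ξ 1)])
  have hnorm : ‖(⟨ξ 1, ξ 0⟩ : ℂ)‖ = Real.sin (polarAngle ξ) := by
    rw [polarAngle, Real.sin_arccos, Complex.norm_def, Complex.normSq_mk]
    congr 1
    linarith
  have hS : Real.sin (polarAngle ξ) * Real.sin (azimuth ξ) = ξ 0 := by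
    rw [← hnorm]; exact Complex.norm_mul_sin_arg _
  have hC : Real.sin (polarAngle ξ) * Real.cos (azimuth ξ) = ξ 1 := by
    rw [← hnorm]; exact Complex.norm_mul_cos_arg _
  have hr := Real.sin_sq_add_cos_sq (polarAngle ξ)
  have hsc := Real.sin_sq_add_cos_sq (azimuth ξ)
  rw [inner_euc_three, ← hS, ← hC, ← hcos] at h
  refine ⟨⟪η, xiAlpha ξ⟫, ⟪η, xiBeta ξ⟫, ?_⟩
  rw [inner_euc_three, inner_euc_three]
  ext k
  fin_cases k <;> simp [xiAlpha, xiBeta] <;>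
    generalize Real.sin (polarAngle ξ) = r at * <;>
    generalize Real.sin (azimuth ξ) = S at * <;>
    generalize Real.cos (azimuth ξ) = C at * <;>
    generalize Real.cos (polarAngle ξ) = z at *
  · linear_combination (-η.ofLp 0) * hsc - (S * (η.ofLp 0 * S + η.ofLp 1 * C)) * hr + S * r * h
  · linear_combination (-η.ofLp 1) * hsc - (C * (η.ofLp 0 * S + η.ofLp 1 * C)) * hr + C * r * h
  · linear_combination (-η.ofLp 2) * hr + z * h

end Frame

section HalfLines

/-- A continuous compactly supported function is integrable along every line. -/
lemma integrable_line {E F : Type*} [NormedAddCommGroup E] [NormedSpace ℝ E]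
    [NormedAddCommGroup F] {h : E → F} (hc : Continuous h)
    (hs : HasCompactSupport h) (a : E) {ξ : E} (hξ : ξ ≠ 0) :
    Integrable fun t : ℝ => h (a + t • ξ) := by
  have he : Topology.IsClosedEmbedding fun t : ℝ => a + t • ξ :=
    (Homeomorph.addLeft a).isClosedEmbedding.comp (isClosedEmbedding_smul_left hξ)
  exact (hc.comp he.continuous).integrable_of_hasCompactSupport (hs.comp_isClosedEmbedding he)

variable {m : ℕ} {B γ : Set (Euc 3)} {f : Euc 3 → Tensor m (Euc 3)}

lemma IsSymmTensorFieldIn.hasCompactSupport (hf : IsSymmTensorFieldIn m 3 B f)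
    (hB : Bornology.IsBounded B) : HasCompactSupport f := by
  refine HasCompactSupport.intro hB.isCompact_closure fun x hx => hf.supp x fun hxB => ?_
  exact hx (subset_closure hxB)

lemma IsSymmTensorFieldIn.contDiff_apply (hf : IsSymmTensorFieldIn m 3 B f)
    (v : Fin m → Euc 3) : ContDiff ℝ ∞ fun x => f x v :=
  (ContinuousMultilinearMap.apply ℝ (fun _ : Fin m => Euc 3) ℝ v).contDiff.comp hf.smooth

lemma IsSymmTensorFieldIn.hasCompactSupport_apply (hf : IsSymmTensorFieldIn m 3 B f)
    (hB : Bornology.IsBounded B) (v : Fin m → Euc 3) : HasCompactSupport fun x => f x v :=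
  (hf.hasCompactSupport hB).comp_left (g := fun T : Tensor m (Euc 3) => T v) rfl

/-- If the transverse ray transform vanishes on the lines through `γ`, so do the integrals of all
powers of transverse vectors along these lines. -/
lemma integral_line_eq_zero (hf : IsSymmTensorFieldIn m 3 B f) (hB : Bornology.IsBounded B)
    (h0 : restrictedTransverseRay γ f = 0) {a ξ η : Euc 3} (ha : a ∈ γ) (hξ : ‖ξ‖ = 1)
    (hη : ⟪η, ξ⟫ = 0) : ∫ t : ℝ, f (a + t • ξ) (fun _ => η) = 0 := by
  have hξ0 : ξ ≠ 0 := by rintro rfl; simp at hξ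
  have hmix : ∀ i ∈ Finset.range (m + 1),
      ∫ t : ℝ, f (a + t • ξ) (mixArg m i (xiAlpha ξ) (xiBeta ξ)) = 0 := by
    intro i hi
    have hl : ⟪a - ⟪a, ξ⟫ • ξ, ξ⟫ = 0 := by
      rw [inner_sub_left, inner_smul_left, real_inner_self_eq_norm_sq, hξ]; simp
    let l : LineThrough γ := ⟨(a - ⟪a, ξ⟫ • ξ, ξ), hξ, hl, ⟪a, ξ⟫, by simpa using ha⟩
    have h1 : transverseRay f ⟨i, Finset.mem_range.1 hi⟩ (a - ⟪a, ξ⟫ • ξ) ξ = 0 :=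
      congrFun (congrFun h0 l) ⟨i, Finset.mem_range.1 hi⟩
    rw [transverseRay, ← integral_add_right_eq_self _ (⟪a, ξ⟫ : ℝ)] at h1
    rw [← h1]
    congr 1
    funext t
    rw [symPairing_of_isSymmTensor (hf.symm _),
      show a - ⟪a, ξ⟫ • ξ + (t + ⟪a, ξ⟫) • ξ = a + t • ξ by module]
    rfl
  obtain ⟨u, w, rfl⟩ := exists_eq_xiAlpha_add_xiBeta hξ hη
  simp_rw [(hf.symm _).apply_add]
  rw [integral_finsetSum _ fun i _ => ((integrable_line (hf.contDiff_apply _).continuous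
    (hf.hasCompactSupport_apply hB _) a hξ0).const_mul _).const_mul _]
  refine Finset.sum_eq_zero fun i hi => ?_
  rw [integral_const_mul, integral_const_mul, hmix i hi]
  simp

/-- Since `γ` encompasses `B`, already the integrals over half-lines from points of `γ` vanish. -/
lemma integral_halfLine_eq_zero (hf : IsSymmTensorFieldIn m 3 B f) (hB : Bornology.IsBounded B)
    (henc : Encompasses γ B) (h0 : restrictedTransverseRay γ f = 0) {a ξ η : Euc 3} (ha : a ∈ γ)
    (hξ : ξ ≠ 0) (hη : ⟪η, ξ⟫ = 0) : ∫ t in Set.Ioi (0 : ℝ), f (a + t • ξ) (fun _ => η) = 0 := by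
  have hfull : ∫ t : ℝ, f (a + t • ξ) (fun _ => η) = 0 := by
    have hn : ‖ξ‖ ≠ 0 := norm_ne_zero_iff.2 hξ
    have h1 := integral_line_eq_zero hf hB h0 ha (ξ := ‖ξ‖⁻¹ • ξ) (η := η)
      (by simp [norm_smul, hn]) (by rw [inner_smul_right, hη, mul_zero])
    have h2 := Measure.integral_comp_mul_left
      (fun t : ℝ => f (a + t • (‖ξ‖⁻¹ • ξ)) (fun _ => η)) ‖ξ‖
    rw [h1, smul_zero] at h2
    rw [← h2]
    congr 1
    funext t
    rw [smul_smul, mul_right_comm, mul_inv_cancel₀ hn, one_mul]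
  by_cases hpos : ∃ t : ℝ, 0 ≤ t ∧ a + t • ξ ∈ B
  · refine Eq.trans ?_ hfull
    refine setIntegral_eq_integral_of_forall_compl_eq_zero fun t ht => ?_
    rw [hf.supp _ fun hB' => henc.2 a ha ξ hξ ⟨hpos, t, not_lt.1 ht, hB'⟩]
    simp
  · refine setIntegral_eq_zero_of_forall_eq_zero fun t ht => ?_
    rw [hf.supp _ fun hB' => hpos ⟨t, le_of_lt ht, hB'⟩]
    simp

end HalfLines

/-! ### Differentiation under the integral sign -/

section ParametricIntegral

/-- Differentiation under the integral sign for integrands that vanish outside a fixed compact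
set. -/
lemma hasDerivAt_integral_of_isCompact {X : Type*} [TopologicalSpace X] [T2Space X]
    [MeasurableSpace X] [OpensMeasurableSpace X] {μ : Measure X} [IsFiniteMeasureOnCompacts μ]
    {F F' : ℝ → X → ℝ} (hF : Continuous (Function.uncurry F))
    (hF' : Continuous (Function.uncurry F'))
    (hd : ∀ s x, HasDerivAt (fun s => F s x) (F' s x) s) {K : Set X} (hK : IsCompact K)
    (h0 : ∀ s, ∀ x ∉ K, F s x = 0) (s : ℝ) :
    HasDerivAt (fun s => ∫ x, F s x ∂μ) (∫ x, F' s x ∂μ) s := by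
  have h0' : ∀ s, ∀ x ∉ K, F' s x = 0 := by
    intro s x hx
    have h1 : (fun s => F s x) = fun _ => 0 := funext fun s => h0 s x hx
    have h2 := hd s x
    rw [h1] at h2
    exact h2.unique (hasDerivAt_const s 0)
  obtain ⟨C, hC⟩ := ((isCompact_closedBall s 1).prod hK).exists_bound_of_continuousOn
    hF'.continuousOn
  have hcont : ∀ s, Continuous (F s) := fun s => hF.comp (by fun_prop : Continuous fun x => (s, x))
  have hcont' : ∀ s, Continuous (F' s) :=
    fun s => hF'.comp (by fun_prop : Continuous fun x => (s, x))
  refine (hasDerivAt_integral_of_dominated_loc_of_deriv_le (bound := K.indicator fun _ => C)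
    (closedBall_mem_nhds s one_pos) (Filter.Eventually.of_forall fun s =>
      (hcont s).aestronglyMeasurable) ?_ (hcont' s).aestronglyMeasurable
    (Filter.Eventually.of_forall fun x t ht => ?_) ?_
    (Filter.Eventually.of_forall fun x t _ => hd t x)).2
  · exact (hcont s).integrable_of_hasCompactSupport (HasCompactSupport.intro hK (h0 s))
  · by_cases hx : x ∈ K
    · simpa [hx] using hC (t, x) ⟨ht, hx⟩
    · simp [hx, h0' t x hx]
  · exact (integrableOn_const hK.measure_lt_top.ne).integrable_indicator hK.measurableSet

end ParametricIntegral

/-! ### Directional derivatives -/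

section DirDeriv

variable {E F : Type*} [NormedAddCommGroup E] [NormedSpace ℝ E] [NormedAddCommGroup F]
  [NormedSpace ℝ F]

/-- The derivative of `h` in the direction `w`, as a function on the whole space, so that it can
be iterated. -/
noncomputable def dirDeriv (w : E) (h : E → F) : E → F := fun x => fderiv ℝ h x w

lemma ContDiff.iterate_dirDeriv {h : E → F} (hh : ContDiff ℝ ∞ h) (w : E) (k : ℕ) :
    ContDiff ℝ ∞ ((dirDeriv w)^[k] h) := by
  induction k with
  | zero => exact hh
  | succ k ih =>
    rw [Function.iterate_succ_apply']
    exact (ih.fderiv_right (m := ∞) le_rfl).clm_apply contDiff_const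

lemma HasCompactSupport.iterate_dirDeriv {h : E → F} (hh : HasCompactSupport h) (w : E) (k : ℕ) :
    HasCompactSupport ((dirDeriv w)^[k] h) := by
  induction k with
  | zero => exact hh
  | succ k ih =>
    rw [Function.iterate_succ_apply']
    exact ih.fderiv_apply ℝ w

lemma iterate_dirDeriv_eq_zero {h : E → F} {U : Set E} (hU : IsOpen U) (h0 : ∀ x ∈ U, h x = 0)
    (w : E) (k : ℕ) : ∀ x ∈ U, (dirDeriv w)^[k] h x = 0 := by
  induction k with
  | zero => exact h0
  | succ k ih =>
    intro x hx
    rw [Function.iterate_succ_apply']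
    have he : (dirDeriv w)^[k] h =ᶠ[nhds x] fun _ => 0 :=
      Filter.eventually_of_mem (hU.mem_nhds hx) ih
    rw [dirDeriv, he.fderiv_eq]
    simp

lemma iterate_dirDeriv_apply {m : ℕ} {V : Type*} [NormedAddCommGroup V] [NormedSpace ℝ V]
    {f : E → Tensor m V} (hf : ContDiff ℝ ∞ f) (w : E) (v : Fin m → V) (k : ℕ) :
    (dirDeriv w)^[k] (fun x => f x v) = fun x => (dirDeriv w)^[k] f x v := by
  induction k with
  | zero => rfl
  | succ k ih =>
    rw [Function.iterate_succ_apply', Function.iterate_succ_apply', ih]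
    funext x
    have hd := ((hf.iterate_dirDeriv w k).differentiable (by simp)).differentiableAt (x := x)
    have h1 := (ContinuousMultilinearMap.apply ℝ (fun _ : Fin m => V) ℝ v).hasFDerivAt.comp x
      hd.hasFDerivAt
    have h2 : fderiv ℝ (fun x => (dirDeriv w)^[k] f x v) x = _ := h1.fderiv
    rw [dirDeriv, dirDeriv, h2]
    rfl

end DirDeriv

/-! ### The jet of the ray data in the direction normal to a plane -/

section Jet

variable {h : Euc 3 → ℝ} {a θ w : Euc 3}

/-- The derivatives of the integrals over the half-lines from `a` as their direction `θ` moves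
along `w`. -/
lemma hasDerivAt_integral_halfLine (hc : ContDiff ℝ ∞ h) (hs : HasCompactSupport h)
    (hθ : ‖θ‖ = 1) (hw : ⟪w, θ⟫ = 0) (k : ℕ) (s : ℝ) :
    HasDerivAt
      (fun s => ∫ t in Set.Ioi (0 : ℝ), t ^ k * (dirDeriv w)^[k] h (a + t • (θ + s • w)))
      (∫ t in Set.Ioi (0 : ℝ), t ^ (k + 1) * (dirDeriv w)^[k + 1] h (a + t • (θ + s • w))) s := by
  have hck := hc.iterate_dirDeriv w k
  obtain ⟨R, hR⟩ := (hs.iterate_dirDeriv w k).isCompact.isBounded.exists_norm_le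
  have hlow : ∀ s t : ℝ, |t| ≤ ‖t • (θ + s • w)‖ := by
    intro s t
    rw [norm_smul, Real.norm_eq_abs]
    refine le_mul_of_one_le_right (abs_nonneg t) ?_
    have h1 := norm_add_sq_real θ (s • w)
    rw [inner_smul_right, real_inner_comm, hw, hθ] at h1
    nlinarith [norm_nonneg (θ + s • w), sq_nonneg ‖s • w‖]
  refine hasDerivAt_integral_of_isCompact (K := closedBall (0 : ℝ) (R + ‖a‖))
    (F := fun s t => t ^ k * (dirDeriv w)^[k] h (a + t • (θ + s • w)))
    (F' := fun s t => t ^ (k + 1) * (dirDeriv w)^[k + 1] h (a + t • (θ + s • w)))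
    ?_ ?_ (fun s t => ?_) (isCompact_closedBall _ _) (fun s t ht => ?_) s
  · have := hck.continuous
    simp only [Function.uncurry_def]
    fun_prop
  · have := (hc.iterate_dirDeriv w (k + 1)).continuous
    simp only [Function.uncurry_def]
    fun_prop
  · have hline : HasDerivAt (fun s : ℝ => a + t • (θ + s • w)) (t • w) s := by
      simpa using ((((hasDerivAt_id s).smul_const w).const_add θ).const_smul t).const_add a
    have hd := ((hck.differentiable (by simp)).differentiableAt
      (x := a + t • (θ + s • w))).hasFDerivAt.comp_hasDerivAt s hline
    refine (hd.const_mul (t ^ k)).congr_deriv ?_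
    rw [Function.iterate_succ_apply', dirDeriv, map_smul, smul_eq_mul]
    ring
  · refine mul_eq_zero_of_right _ ?_
    by_contra hne
    have h1 := hR _ (subset_tsupport _ hne)
    have h2 := norm_sub_le (a + t • (θ + s • w)) a
    rw [add_sub_cancel_left] at h2
    refine ht ?_
    rw [mem_closedBall_zero_iff, Real.norm_eq_abs]
    linarith [hlow s t]

lemma iteratedDeriv_integral_halfLine (hc : ContDiff ℝ ∞ h) (hs : HasCompactSupport h)
    (hθ : ‖θ‖ = 1) (hw : ⟪w, θ⟫ = 0) (k : ℕ) :
    iteratedDeriv k (fun s : ℝ => ∫ t in Set.Ioi (0 : ℝ), h (a + t • (θ + s • w))) =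
      fun s : ℝ => ∫ t in Set.Ioi (0 : ℝ), t ^ k * (dirDeriv w)^[k] h (a + t • (θ + s • w)) := by
  induction k with
  | zero => simp
  | succ k ih =>
    rw [iteratedDeriv_succ, ih]
    funext s
    exact (hasDerivAt_integral_halfLine hc hs hθ hw k s).deriv

lemma contDiff_integral_halfLine (hc : ContDiff ℝ ∞ h) (hs : HasCompactSupport h)
    (hθ : ‖θ‖ = 1) (hw : ⟪w, θ⟫ = 0) :
    ContDiff ℝ ∞ fun s : ℝ => ∫ t in Set.Ioi (0 : ℝ), h (a + t • (θ + s • w)) := by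
  refine contDiff_of_differentiable_iteratedDeriv fun k _ => ?_
  rw [iteratedDeriv_integral_halfLine hc hs hθ hw k]
  exact fun s => (hasDerivAt_integral_halfLine hc hs hθ hw k s).differentiableAt

lemma iteratedDeriv_pow_mul_zero {G : ℝ → ℝ} (hG : ContDiff ℝ ∞ G) {n i : ℕ} (hi : i ≤ n) :
    iteratedDeriv n (fun s => s ^ i * G s) 0 =
      n.descFactorial i * iteratedDeriv (n - i) G 0 := by
  rw [iteratedDeriv_fun_mul (by fun_prop) (hG.contDiffAt.of_le (by exact_mod_cast le_top)),
    Finset.sum_eq_single_of_mem i (Finset.mem_range.2 (by omega))]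
  · rw [iteratedDeriv_fun_pow_zero, if_pos rfl, Nat.descFactorial_eq_factorial_mul_choose]
    push_cast
    ring
  · intro j _ hj
    rw [iteratedDeriv_fun_pow_zero, if_neg hj]
    simp

/-- The coefficient that the `(m + 1)`-st derivative at `s = 0` of
`∑ i, binom m i * (-s)^i * G i s` gives to the `(m + 1 - i)`-th derivative of `G i`. -/
def jetCoeff (m i : ℕ) : ℝ := m.choose i * (-1) ^ i * (m + 1).descFactorial i

/-- The `(m + 1)`-st derivative at the plane `w^⊥` of the ray data, weighted with powers of the
distance to the source in such a way that integration over all directions of the plane will yield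
integrals over the plane with respect to its area. -/
lemma integral_halfLine_jet {m : ℕ} {h : ℕ → Euc 3 → ℝ} (hc : ∀ i, ContDiff ℝ ∞ (h i))
    (hs : ∀ i, HasCompactSupport (h i)) (hθ : ‖θ‖ = 1) (hw : ⟪w, θ⟫ = 0) (κ : ℝ)
    (h0 : ∀ s : ℝ, ∑ i ∈ Finset.range (m + 1), (m.choose i : ℝ) * ((-s) ^ i * κ ^ (m - i) *
      ∫ t in Set.Ioi (0 : ℝ), h i (a + t • (θ + s • w))) = 0) :
    ∫ t in Set.Ioi (0 : ℝ), t * ∑ i ∈ Finset.range (m + 1), jetCoeff m i * (t * κ) ^ (m - i) *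
      (dirDeriv w)^[m + 1 - i] (h i) (a + t • θ) = 0 := by
  have hθ0 : θ ≠ 0 := by rintro rfl; simp at hθ
  set G : ℕ → ℝ → ℝ := fun i s => ∫ t in Set.Ioi (0 : ℝ), h i (a + t • (θ + s • w)) with hG
  have hGc : ∀ i, ContDiff ℝ ∞ (G i) := fun i => contDiff_integral_halfLine (hc i) (hs i) hθ hw
  have hGk : ∀ i k, iteratedDeriv k (G i) 0
      = ∫ t in Set.Ioi (0 : ℝ), t ^ k * (dirDeriv w)^[k] (h i) (a + t • θ) := by
    intro i k
    rw [iteratedDeriv_integral_halfLine (hc i) (hs i) hθ hw k]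
    simp
  have h1 : (fun s => ∑ i ∈ Finset.range (m + 1),
      ((m.choose i : ℝ) * (-1) ^ i * κ ^ (m - i)) * (s ^ i * G i s)) = fun _ => 0 := by
    funext s
    rw [← h0 s]
    refine Finset.sum_congr rfl fun i _ => ?_
    rw [neg_pow s]
    ring
  have h2 := congrArg (fun F => iteratedDeriv (m + 1) F 0) h1
  simp only [iteratedDeriv_const] at h2
  rw [iteratedDeriv_fun_sum fun i _ => by
    have := (hGc i).contDiffAt (x := 0)
    exact (contDiffAt_const.mul ((contDiffAt_id.pow i).mul this)).of_le
      (by exact_mod_cast le_top)] at h2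
  have h3 : ∑ i ∈ Finset.range (m + 1), jetCoeff m i * (κ ^ (m - i) *
      ∫ t in Set.Ioi (0 : ℝ), t ^ (m + 1 - i) *
        (dirDeriv w)^[m + 1 - i] (h i) (a + t • θ)) = 0 := by
    simp only [Nat.add_eq_zero_iff, one_ne_zero, and_false, if_false] at h2
    refine Eq.trans ?_ h2
    refine Finset.sum_congr rfl fun i hi => ?_
    rw [iteratedDeriv_const_mul_field,
      iteratedDeriv_pow_mul_zero (hGc i) (by have := Finset.mem_range.1 hi; omega), hGk,
      jetCoeff]
    ring
  refine Eq.trans ?_ h3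
  have hint : ∀ i k, Integrable
      (fun t : ℝ => t ^ k * (dirDeriv w)^[m + 1 - i] (h i) (a + t • θ)) := by
    intro i k
    have hl : Topology.IsClosedEmbedding fun t : ℝ => a + t • θ :=
      (Homeomorph.addLeft a).isClosedEmbedding.comp (isClosedEmbedding_smul_left hθ0)
    have hcont := ((hc i).iterate_dirDeriv w (m + 1 - i)).continuous
    refine Continuous.integrable_of_hasCompactSupport (by fun_prop) ?_
    exact (((hs i).iterate_dirDeriv w _).comp_isClosedEmbedding hl).mul_left
  simp_rw [Finset.mul_sum, ← integral_const_mul]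
  rw [← integral_finsetSum _ fun i _ => ((hint i _).integrableOn.const_mul _).const_mul _]
  refine integral_congr_ae (Filter.Eventually.of_forall fun t => ?_)
  refine Finset.sum_congr rfl fun i hi => ?_
  rw [show m + 1 - i = (m - i) + 1 by have := Finset.mem_range.1 hi; omega]
  ring

end Jet

/-! ### Integrals over planes -/

section Planes

/-- The point with coordinates `(p, y₁, y₂)` with respect to the orthonormal basis `b`; for fixed
`p` these are the points of the plane `{x : ⟨b 0, x⟩ = p}`. -/
noncomputable def planePoint (b : OrthonormalBasis (Fin 3) ℝ (Euc 3)) (p : ℝ) (y : ℝ × ℝ) : Euc 3 :=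
  p • b 0 + (y.1 • b 1 + y.2 • b 2)

/-- A function on the plane has integral zero if its integrals over all half-lines from the origin,
weighted with the distance to the origin, vanish. -/
lemma integral_plane_eq_zero_of_halfLines {Φ : Euc 3 → ℝ} (e₁ e₂ : Euc 3)
    (h : ∀ φ : ℝ, ∫ t in Set.Ioi (0 : ℝ), t * Φ (t • (Real.cos φ • e₁ + Real.sin φ • e₂)) = 0) :
    ∫ y : ℝ × ℝ, Φ (y.1 • e₁ + y.2 • e₂) = 0 := by
  rw [← integral_comp_polarCoord_symm, polarCoord_target]
  by_cases hi : IntegrableOn (fun q : ℝ × ℝ => q.1 •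
      Φ ((polarCoord.symm q).1 • e₁ + (polarCoord.symm q).2 • e₂))
      (Set.Ioi (0 : ℝ) ×ˢ Set.Ioo (-Real.pi) Real.pi) (volume.prod volume)
  · rw [Measure.volume_eq_prod, ← setIntegral_prod_swap]
    refine (setIntegral_prod _ hi.swap).trans ?_
    simp only [smul_add, smul_smul] at h
    simp [polarCoord_symm_apply, h]
  · exact integral_undef hi

end Planes

/-! ### The relations on a plane -/

section PlaneRelations

lemma inner_basis_zero_planePoint (b : OrthonormalBasis (Fin 3) ℝ (Euc 3)) (p : ℝ) (y : ℝ × ℝ) :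
    ⟪b 0, planePoint b p y⟫ = p := by
  have h := fun i j => orthonormal_iff_ite.1 b.orthonormal i j
  simp [planePoint, inner_add_right, inner_smul_right, h]

lemma continuous_planePoint (b : OrthonormalBasis (Fin 3) ℝ (Euc 3)) (p : ℝ) :
    Continuous fun y : ℝ × ℝ => planePoint b p y := by
  unfold planePoint
  fun_prop

lemma norm_le_norm_planePoint (b : OrthonormalBasis (Fin 3) ℝ (Euc 3)) (p : ℝ) (y : ℝ × ℝ) :
    ‖(p, y)‖ ≤ ‖planePoint b p y‖ := by
  have h := fun i j => orthonormal_iff_ite.1 b.orthonormal i j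
  have hk : ∀ k, |⟪b k, planePoint b p y⟫| ≤ ‖planePoint b p y‖ := by
    intro k
    simpa using abs_real_inner_le_norm (b k) (planePoint b p y)
  have h0 := hk 0
  have h1 := hk 1
  have h2 := hk 2
  simp [planePoint, inner_add_right, inner_smul_right, h] at h0 h1 h2
  rw [Prod.norm_def, Prod.norm_def]
  exact max_le h0 (max_le h1 h2)

/-- The coefficient of `(-τ)^(m - l) * κ^(l - i) * g i` in the expansion of
`∑ i, jetCoeff m i * (κ - τ)^(m - i) * g i`. -/
noncomputable def momentCoeff (m l i : ℕ) : ℝ := jetCoeff m i * (m - i).choose (l - i)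

lemma sum_jetCoeff_mul_sub_pow (m : ℕ) (κ τ : ℝ) (g : ℕ → ℝ) :
    ∑ i ∈ Finset.range (m + 1), jetCoeff m i * (κ - τ) ^ (m - i) * g i =
      ∑ l ∈ Finset.range (m + 1), (-τ) ^ (m - l) *
        ∑ i ∈ Finset.range (l + 1), momentCoeff m l i * κ ^ (l - i) * g i := by
  simp_rw [Finset.mul_sum]
  rw [Finset.sum_comm' (t' := Finset.range (m + 1)) (s' := fun i => Finset.Ico i (m + 1))
    (by intro l i; simp only [Finset.mem_range, Finset.mem_Ico]; omega)]
  refine Finset.sum_congr rfl fun i hi => ?_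
  have hi' := Finset.mem_range.1 hi
  rw [Finset.sum_Ico_eq_sum_range, sub_eq_add_neg, add_pow, Finset.mul_sum, Finset.sum_mul,
    show m + 1 - i = m - i + 1 by omega]
  refine Finset.sum_congr rfl fun j _ => ?_
  rw [momentCoeff, Nat.add_sub_cancel_left, show m - (i + j) = m - i - j by omega]
  ring

/-- A polynomial of degree at most `m` in `τ` that vanishes at `m + 1` points has vanishing
coefficients. -/
lemma coeff_eq_zero_of_forall_sum_eq_zero {m : ℕ} {Q : ℕ → ℝ} {τ : Fin (m + 1) → ℝ}
    (hτ : Function.Injective τ)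
    (h : ∀ j, ∑ l ∈ Finset.range (m + 1), (-τ j) ^ (m - l) * Q l = 0) {l : ℕ} (hl : l ≤ m) :
    Q l = 0 := by
  set P : Polynomial ℝ := ∑ l ∈ Finset.range (m + 1), Polynomial.monomial (m - l) (Q l) with hP
  have hdeg : P.natDegree ≤ m := Polynomial.natDegree_sum_le_of_forall_le _ _ fun l _ =>
    (Polynomial.natDegree_monomial_le _).trans (Nat.sub_le _ _)
  have hP0 : P = 0 := by
    refine P.eq_zero_of_natDegree_lt_card_of_eval_eq_zero (f := fun j => -τ j)
      (fun i j hij => hτ (neg_injective hij)) (fun j => ?_) (by simpa using Nat.lt_succ_of_le hdeg)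
    rw [← h j, hP, Polynomial.eval_finsetSum]
    refine Finset.sum_congr rfl fun l _ => ?_
    rw [Polynomial.eval_monomial, mul_comm]
  have hcoeff : P.coeff (m - l) = Q l := by
    rw [hP, Polynomial.finsetSum_coeff,
      Finset.sum_eq_single_of_mem l (Finset.mem_range.2 (by omega))]
    · rw [Polynomial.coeff_monomial, if_pos rfl]
    · intro k hk hkl
      have := Finset.mem_range.1 hk
      rw [Polynomial.coeff_monomial, if_neg (by omega)]
  rw [← hcoeff, hP0, Polynomial.coeff_zero]

variable {m : ℕ} {B γ : Set (Euc 3)} {f : Euc 3 → Tensor m (Euc 3)}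

/-- The moment integrand: the `x`-dependent part of the coefficient of `(-τ)^(m - l)` in the
polynomial relation between the integrals of the derivatives of `f` over a plane with normal `w`,
tested with powers of `c`. -/
noncomputable def momentIntegrand (f : Euc 3 → Tensor m (Euc 3)) (w c : Euc 3) (l : ℕ) (x : Euc 3) :
    ℝ :=
  ∑ i ∈ Finset.range (l + 1), momentCoeff m l i * ⟪c, x⟫ ^ (l - i) *
    (dirDeriv w)^[m + 1 - i] f x (mixArg m i c w)

lemma continuous_mixArg {X : Type*} [TopologicalSpace X] {u v : X → Euc 3} (hu : Continuous u)
    (hv : Continuous v) (i : ℕ) : Continuous fun x => mixArg m i (u x) (v x) := by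
  refine continuous_pi fun k => ?_
  by_cases hk : (k : ℕ) < i <;> simpa [mixArg, hk]

lemma IsSymmTensorFieldIn.continuous_momentIntegrand {X : Type*} [TopologicalSpace X]
    (hf : IsSymmTensorFieldIn m 3 B f) (w : Euc 3) (l : ℕ) {u v : X → Euc 3} (hu : Continuous u)
    (hv : Continuous v) : Continuous fun x => momentIntegrand f w (u x) l (v x) := by
  unfold momentIntegrand
  refine continuous_finsetSum _ fun i _ => ?_
  have h1 := (hf.smooth.iterate_dirDeriv w (m + 1 - i)).continuous
  refine Continuous.mul (by fun_prop) ?_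
  exact (h1.comp hv).eval (continuous_mixArg hu continuous_const i)

lemma momentIntegrand_eq_zero {w c x : Euc 3} {l : ℕ}
    (h : ∀ k, (dirDeriv w)^[k] f x = 0) : momentIntegrand f w c l x = 0 :=
  Finset.sum_eq_zero fun i _ => by rw [h]; simp

lemma IsSymmTensorFieldIn.exists_forall_dirDeriv_eq_zero (hf : IsSymmTensorFieldIn m 3 B f)
    (hB : Bornology.IsBounded B) (w : Euc 3) :
    ∃ R : ℝ, ∀ x, R < ‖x‖ → ∀ k, (dirDeriv w)^[k] f x = 0 := by
  obtain ⟨R, hR⟩ := hB.exists_norm_le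
  refine ⟨R, fun x hx k => iterate_dirDeriv_eq_zero (U := {x | R < ‖x‖})
    (isOpen_lt continuous_const continuous_norm) (fun y hy => hf.supp y fun hyB => ?_) w k x hx⟩
  exact absurd (hR y hyB) (not_le.2 hy)

/-- The relation that a source `a` on the plane `{x : ⟨b 0, x⟩ = p}` yields. -/
lemma integral_plane_source (hf : IsSymmTensorFieldIn m 3 B f) (hB : Bornology.IsBounded B)
    (henc : Encompasses γ B) (h0 : restrictedTransverseRay γ f = 0)
    (b : OrthonormalBasis (Fin 3) ℝ (Euc 3)) {p : ℝ} {a : Euc 3} (ha : a ∈ γ)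
    (hap : ⟪b 0, a⟫ = p) {c : Euc 3} (hc : ⟪b 0, c⟫ = 0) :
    ∫ y : ℝ × ℝ, ∑ i ∈ Finset.range (m + 1),
      jetCoeff m i * (⟪c, planePoint b p y⟫ - ⟪c, a⟫) ^ (m - i) *
        (dirDeriv (b 0))^[m + 1 - i] f (planePoint b p y) (mixArg m i c (b 0)) = 0 := by
  have hb := fun i j => orthonormal_iff_ite.1 b.orthonormal i j
  have hplane := integral_plane_eq_zero_of_halfLines (b 1) (b 2)
    (Φ := fun z => ∑ i ∈ Finset.range (m + 1), jetCoeff m i * ⟪c, z⟫ ^ (m - i) *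
      (dirDeriv (b 0))^[m + 1 - i] f (a + z) (mixArg m i c (b 0))) ?_
  · rw [← integral_add_right_eq_self _ ((⟪b 1, a⟫, ⟪b 2, a⟫) : ℝ × ℝ)]
    refine Eq.trans ?_ hplane
    congr 1
    funext y
    have hpt : planePoint b p (y + (⟪b 1, a⟫, ⟪b 2, a⟫)) = a + (y.1 • b 1 + y.2 • b 2) := by
      have h1 := b.sum_repr' a
      rw [Fin.sum_univ_three, hap] at h1
      conv_rhs => rw [← h1]
      simp only [planePoint, Prod.fst_add, Prod.snd_add]
      module
    rw [hpt]
    refine Finset.sum_congr rfl fun i _ => ?_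
    rw [inner_add_right, add_sub_cancel_left]
  · intro φ
    set θ := Real.cos φ • b 1 + Real.sin φ • b 2 with hθ
    have hθw : ⟪b 0, θ⟫ = 0 := by
      simp [hθ, inner_add_right, inner_smul_right, hb]
    have hθn : ‖θ‖ = 1 := by
      have h1 := real_inner_self_eq_norm_sq θ
      simp only [hθ, inner_add_right, inner_add_left, inner_smul_right, inner_smul_left, hb] at h1
      simp at h1
      have h2 : ‖θ‖ ^ 2 = 1 := by
        rw [hθ, ← h1]
        linarith [Real.sin_sq_add_cos_sq φ]
      exact (pow_eq_one_iff_of_nonneg (norm_nonneg _) two_ne_zero).1 h2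
    have hjet := integral_halfLine_jet (m := m) (a := a) (θ := θ) (w := b 0)
      (h := fun i x => f x (mixArg m i c (b 0))) (fun i => hf.contDiff_apply _)
      (fun i => hf.hasCompactSupport_apply hB _) hθn hθw ⟪c, θ⟫ ?_
    · refine Eq.trans ?_ hjet
      congr 1
      funext t
      congr 1
      refine Finset.sum_congr rfl fun i _ => ?_
      rw [inner_smul_right, iterate_dirDeriv_apply hf.smooth]
    · intro s
      have hξ : θ + s • b 0 ≠ 0 := by
        intro h
        have h1 : ⟪θ, θ + s • b 0⟫ = 1 := by
          rw [inner_add_right, inner_smul_right, real_inner_comm (b 0) θ, hθw,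
            real_inner_self_eq_norm_sq, hθn]
          simp
        rw [h, inner_zero_right] at h1
        exact zero_ne_one h1
      -- the vector `⟨c, θ⟩ w - s c` is transverse to the direction `θ + s w`
      have hη : ⟪(-s) • c + ⟪c, θ⟫ • b 0, θ + s • b 0⟫ = 0 := by
        simp only [inner_add_left, inner_add_right, inner_smul_left, inner_smul_right, hθw,
          real_inner_comm (b 0) c, hc, hb]
        simp
      have h1 := integral_halfLine_eq_zero hf hB henc h0 ha hξ hη
      simp_rw [(hf.symm _).apply_add] at h1
      rw [integral_finsetSum _ fun i _ => (((integrable_line (hf.contDiff_apply _).continuous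
        (hf.hasCompactSupport_apply hB _) a hξ).const_mul _).const_mul _).integrableOn] at h1
      refine Eq.trans (Finset.sum_congr rfl fun i _ => ?_) h1
      rw [integral_const_mul, integral_const_mul]

lemma IsSymmTensorFieldIn.integrable_plane (hf : IsSymmTensorFieldIn m 3 B f)
    (hB : Bornology.IsBounded B) (w c : Euc 3) (b : OrthonormalBasis (Fin 3) ℝ (Euc 3)) (p : ℝ)
    (l : ℕ) : Integrable fun y : ℝ × ℝ => momentIntegrand f w c l (planePoint b p y) := by
  obtain ⟨R, hR⟩ := hf.exists_forall_dirDeriv_eq_zero hB w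
  refine Continuous.integrable_of_hasCompactSupport ?_ ?_
  · exact hf.continuous_momentIntegrand w l continuous_const (continuous_planePoint b p)
  · refine HasCompactSupport.intro (isCompact_closedBall 0 R) fun y hy => ?_
    refine momentIntegrand_eq_zero (hR _ (lt_of_lt_of_le ?_ (norm_le_norm_planePoint b p y)))
    rw [mem_closedBall_zero_iff, not_le] at hy
    exact hy.trans_le (by rw [Prod.norm_def (p, y)]; exact le_max_right _ _)

/-- If a plane contains `m + 1` points of `γ`, the coefficients of the polynomial relation vanish
one by one. -/
lemma integral_momentIntegrand_eq_zero (hf : IsSymmTensorFieldIn m 3 B f)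
    (hB : Bornology.IsBounded B) (henc : Encompasses γ B) (h0 : restrictedTransverseRay γ f = 0)
    (b : OrthonormalBasis (Fin 3) ℝ (Euc 3)) {p : ℝ} {g : Fin (m + 1) → Euc 3}
    (hg : Function.Injective g) (hgγ : ∀ j, g j ∈ γ) (hgp : ∀ j, ⟪b 0, g j⟫ = p)
    {c : Euc 3} (hc : ⟪b 0, c⟫ = 0) {l : ℕ} (hl : l ≤ m) :
    ∫ y : ℝ × ℝ, momentIntegrand f (b 0) c l (planePoint b p y) = 0 := by
  have hb := fun i j => orthonormal_iff_ite.1 b.orthonormal i j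
  have hgen : ∀ c : Euc 3, ⟪b 0, c⟫ = 0 → Function.Injective (fun j => ⟪c, g j⟫) →
      ∫ y : ℝ × ℝ, momentIntegrand f (b 0) c l (planePoint b p y) = 0 := by
    intro c hc hinj
    refine coeff_eq_zero_of_forall_sum_eq_zero
      (Q := fun l => ∫ y : ℝ × ℝ, momentIntegrand f (b 0) c l (planePoint b p y)) hinj
      (fun j => ?_) hl
    have h1 := integral_plane_source hf hB henc h0 b (hgγ j) (hgp j) hc
    simp_rw [sum_jetCoeff_mul_sub_pow] at h1
    change ∫ y : ℝ × ℝ, ∑ l ∈ Finset.range (m + 1), (-⟪c, g j⟫) ^ (m - l) *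
      momentIntegrand f (b 0) c l (planePoint b p y) = 0 at h1
    rw [integral_finsetSum _ fun l _ => (hf.integrable_plane hB (b 0) c b p l).const_mul _] at h1
    simp_rw [integral_const_mul] at h1
    exact h1
  -- almost every vector of the plane separates the points of `γ`; the rest is continuity
  let C : ℝ × ℝ → Euc 3 := fun z => z.1 • b 1 + z.2 • b 2
  have hCc : Continuous C := by fun_prop
  have hC0 : ∀ z, ⟪b 0, C z⟫ = 0 := fun z => by
    simp [C, inner_add_right, inner_smul_right, hb]
  have hdense : Dense {z : ℝ × ℝ | Function.Injective fun j => ⟪C z, g j⟫} := by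
    refine Measure.dense_of_ae (μ := volume) ?_
    have hae : ∀ i j, i ≠ j → ∀ᵐ z : ℝ × ℝ, ⟪C z, g i - g j⟫ ≠ 0 := by
      intro i j hij
      let φ : ℝ × ℝ →ₗ[ℝ] ℝ :=
        { toFun := fun z => ⟪C z, g i - g j⟫
          map_add' := fun z z' => by
            simp only [C, Prod.fst_add, Prod.snd_add, inner_add_left, inner_smul_left]
            simp
            ring
          map_smul' := fun r z => by
            simp only [C, Prod.smul_fst, Prod.smul_snd, inner_add_left, inner_smul_left]
            simp
            ring }
      have hker : LinearMap.ker φ ≠ ⊤ := by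
        intro htop
        have h1 : ⟪b 1, g i - g j⟫ = 0 := by
          have : ((1, 0) : ℝ × ℝ) ∈ LinearMap.ker φ := htop ▸ Submodule.mem_top
          simpa [φ, C] using this
        have h2 : ⟪b 2, g i - g j⟫ = 0 := by
          have : ((0, 1) : ℝ × ℝ) ∈ LinearMap.ker φ := htop ▸ Submodule.mem_top
          simpa [φ, C] using this
        have h3 : ⟪b 0, g i - g j⟫ = 0 := by rw [inner_sub_right, hgp, hgp, sub_self]
        have h4 := b.sum_repr' (g i - g j)
        rw [Fin.sum_univ_three, h1, h2, h3] at h4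
        simp at h4
        exact hij (hg (sub_eq_zero.1 h4.symm))
      have := Measure.addHaar_submodule (volume : Measure (ℝ × ℝ)) _ hker
      exact measure_eq_zero_iff_ae_notMem.1 this
    have hall : ∀ᵐ z : ℝ × ℝ, ∀ i j, i ≠ j → ⟪C z, g i - g j⟫ ≠ 0 := by
      simp_rw [ae_all_iff]
      exact hae
    filter_upwards [hall] with z hz i j hij
    by_contra hne
    exact hz i j hne (by rw [inner_sub_right]; exact sub_eq_zero.2 hij)
  obtain ⟨R, hR⟩ := hf.exists_forall_dirDeriv_eq_zero hB (b 0)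
  have hcont : Continuous fun z : ℝ × ℝ =>
      ∫ y : ℝ × ℝ, momentIntegrand f (b 0) (C z) l (planePoint b p y) := by
    have h1 : ∀ z : ℝ × ℝ, ∫ y : ℝ × ℝ, momentIntegrand f (b 0) (C z) l (planePoint b p y)
        = ∫ y in closedBall (0 : ℝ × ℝ) R,
          momentIntegrand f (b 0) (C z) l (planePoint b p y) := by
      intro z
      refine (setIntegral_eq_integral_of_forall_compl_eq_zero fun y hy => ?_).symm
      refine momentIntegrand_eq_zero (hR _ (lt_of_lt_of_le ?_ (norm_le_norm_planePoint b p y)))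
      rw [mem_closedBall_zero_iff, not_le] at hy
      exact hy.trans_le (by rw [Prod.norm_def (p, y)]; exact le_max_right _ _)
    simp_rw [h1]
    refine continuous_parametric_integral_of_continuous ?_ (isCompact_closedBall _ _)
    exact hf.continuous_momentIntegrand (b 0) l (hCc.comp continuous_fst)
      ((continuous_planePoint b p).comp continuous_snd)
  have hzero := Continuous.ext_on hdense hcont continuous_const fun z hz => hgen _ (hC0 z) hz
  have hcz : c = C (⟪b 1, c⟫, ⟪b 2, c⟫) := by
    have h1 := b.sum_repr' c
    rw [Fin.sum_univ_three, hc, zero_smul, zero_add] at h1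
    exact h1.symm
  rw [hcz]
  exact congrFun hzero _

end PlaneRelations

/-! ### Consequences of the Kirillov–Tuy condition -/

section KirillovTuyPoints

variable {m : ℕ} {B γ : Set (Euc 3)} {f : Euc 3 → Tensor m (Euc 3)}

/-- Almost every plane that meets `B` contains `m + 1` distinct points of `γ`. This is all that is
needed of the Kirillov–Tuy condition. -/
lemma KirillovTuy.ae_exists_injective (hKT : KirillovTuy m 3 B γ) (hB : IsOpen B) :
    ∀ᵐ w : sphere (0 : Euc 3) 1 ∂(volume : Measure (Euc 3)).toSphere, ∀ᵐ p : ℝ,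
      (hyperplane (w : Euc 3) p ∩ B).Nonempty →
        ∃ g : Fin (m + 1) → Euc 3, Function.Injective g ∧ ∀ j, g j ∈ hyperplane (w : Euc 3) p ∩ γ := by
  filter_upwards [Measure.ae_ae_of_ae_prod hKT] with w hw
  filter_upwards [hw] with p hp hne
  obtain ⟨U, g, -, hU, -, hgU, hgen⟩ := hp hne
  have hw1 : ‖(w : Euc 3)‖ = 1 := by simp
  set W := (Submodule.span ℝ {(w : Euc 3)})ᗮ with hW
  have hdense := Measure.dense_of_ae hgen
  have hopen : IsOpen {v : W | p • (w : Euc 3) + (v : Euc 3) ∈ B} :=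
    hB.preimage (by fun_prop)
  obtain ⟨x, hxp, hxB⟩ := hne
  have hxW : x - p • (w : Euc 3) ∈ W := by
    rw [hW, Submodule.mem_orthogonal_singleton_iff_inner_right, inner_sub_right,
      inner_smul_right, real_inner_self_eq_norm_sq, hw1]
    rw [show ⟪(w : Euc 3), x⟫ = p from hxp]
    ring
  obtain ⟨v, hvB, hv⟩ := hdense.inter_open_nonempty _ hopen ⟨⟨_, hxW⟩, by
    rw [Set.mem_ofPred_eq, add_sub_cancel]; exact hxB⟩
  obtain ⟨e, he, hgen⟩ := hv hvB
  have hν : nu m 3 = m + 1 := by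
    rw [nu, show m + 3 - 2 = m + 1 by omega, Nat.choose_succ_self_right]
  have hrank : 1 < Module.finrank ℝ W := by
    have : Fact (Module.finrank ℝ (Euc 3) = 2 + 1) := ⟨by simp⟩
    have hw0 : (w : Euc 3) ≠ 0 := by
      intro h; simp [h] at hw1
    rw [hW, Submodule.finrank_orthogonal_span_singleton (n := 2) hw0]
    norm_num
  have hinj : Function.Injective fun j : Fin (m + 1) => e (Fin.cast hν.symm j) := by
    refine IsGeneric.injective hrank fun S T hS hT hST => hgen S T hS hT fun j => ?_
    exact hST (Fin.cast hν j)
  refine ⟨fun j => g (Fin.cast hν.symm j) ((w : Euc 3), p), fun i j hij => hinj ?_,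
    fun j => hgU _ _ hU hw1⟩
  refine Subtype.ext ?_
  rw [he, he]
  exact congrArg _ hij

/-- For almost every plane with a given normal either the plane meets `B` or all derivatives of `f`
vanish on it, because `B` is connected. -/
lemma ae_nonempty_or_dirDeriv_eq_zero (hf : IsSymmTensorFieldIn m 3 B f) (hB : IsConnected B)
    (w : Euc 3) : ∀ᵐ p : ℝ, (hyperplane w p ∩ B).Nonempty ∨
      ∀ x, ⟪w, x⟫ = p → ∀ k, (dirDeriv w)^[k] f x = 0 := by
  set I : Set ℝ := (fun x => ⟪w, x⟫) '' B with hI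
  have hconv : Convex ℝ I :=
    (hB.isPreconnected.image _ (by fun_prop)).ordConnected.convex
  filter_upwards [measure_eq_zero_iff_ae_notMem.1 (hconv.addHaar_frontier volume)] with p hp
  by_cases hpI : p ∈ I
  · obtain ⟨x, hx, rfl⟩ := hpI
    exact Or.inl ⟨x, rfl, hx⟩
  · refine Or.inr fun x hx k => ?_
    have hcl : p ∉ closure I := fun h => hp ⟨h, fun h' => hpI (interior_subset h')⟩
    refine iterate_dirDeriv_eq_zero (U := {x | ⟪w, x⟫ ∈ (closure I)ᶜ})
      (isClosed_closure.isOpen_compl.preimage (by fun_prop)) (fun y hy => ?_) w k x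
      (by simpa [hx] using hcl)
    exact hf.supp y fun hyB => hy (subset_closure ⟨y, hyB, rfl⟩)

end KirillovTuyPoints

/-! ### Laplace transform of the relations -/

section Laplace

variable {m : ℕ} {B γ : Set (Euc 3)} {f : Euc 3 → Tensor m (Euc 3)}

lemma exists_orthonormalBasis_zero_eq {w : Euc 3} (hw : ‖w‖ = 1) :
    ∃ b : OrthonormalBasis (Fin 3) ℝ (Euc 3), b 0 = w := by
  obtain ⟨b, hb⟩ := Orthonormal.exists_orthonormalBasis_extension_of_card_eq (𝕜 := ℝ)
    (E := Euc 3) (ι := Fin 3) (by simp) (v := fun _ => w) (s := {0}) (by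
      rw [orthonormal_iff_ite]
      rintro ⟨i, rfl⟩ ⟨j, rfl⟩
      simp [hw])
  exact ⟨b, hb 0 rfl⟩

/-- Fubini's theorem for the planes orthogonal to `b 0`. -/
lemma integral_eq_zero_of_ae_plane (b : OrthonormalBasis (Fin 3) ℝ (Euc 3)) {G : Euc 3 → ℝ}
    (h : ∀ᵐ p : ℝ, ∫ y : ℝ × ℝ, G (planePoint b p y) = 0) : ∫ x, G x = 0 := by
  let e : Euc 3 ≃ᵐ ℝ × (ℝ × ℝ) :=
    b.measurableEquiv.trans ((MeasurableEquiv.toLp 2 (Fin 3 → ℝ)).symm.trans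
      ((MeasurableEquiv.piFinSuccAbove (fun _ : Fin 3 => ℝ) 0).trans
        ((MeasurableEquiv.refl ℝ).prodCongr MeasurableEquiv.finTwoArrow)))
  have he : MeasurePreserving e volume volume :=
    b.measurePreserving_measurableEquiv.trans
      ((EuclideanSpace.volume_preserving_symm_measurableEquiv_toLp (Fin 3)).trans
        ((volume_preserving_piFinSuccAbove (fun _ : Fin 3 => ℝ) 0).trans
          ((MeasurePreserving.id volume).prod (volume_preserving_finTwoArrow ℝ))))
  have hpt : ∀ q, e.symm q = planePoint b q.1 q.2 := by
    intro q
    rw [MeasurableEquiv.symm_apply_eq]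
    have hb := fun i j => orthonormal_iff_ite.1 b.orthonormal i j
    have hr : ∀ i, b.repr (planePoint b q.1 q.2) i = ![q.1, q.2.1, q.2.2] i := by
      intro i
      rw [b.repr_apply_apply]
      fin_cases i <;> simp [planePoint, inner_add_right, inner_smul_right, hb]
    refine Prod.ext (hr 0).symm (Prod.ext (hr 1).symm (hr 2).symm)
  have h1 : ∫ x, G x = ∫ q : ℝ × (ℝ × ℝ), G (planePoint b q.1 q.2) := by
    rw [← he.symm.integral_comp' G]
    simp_rw [hpt]
  rw [h1]
  by_cases hi : Integrable fun q : ℝ × (ℝ × ℝ) => G (planePoint b q.1 q.2)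
  · rw [Measure.volume_eq_prod, integral_prod _ hi, integral_congr_ae h]
    simp
  · exact integral_undef hi

/-- Integration by parts: under the Laplace transform the derivative in the direction `w` becomes
multiplication by `-σ`. -/
lemma integral_exp_mul_iterate_dirDeriv {h : Euc 3 → ℝ} (hc : ContDiff ℝ ∞ h)
    (hs : HasCompactSupport h) {w c : Euc 3} (hw : ‖w‖ = 1) (hcw : ⟪w, c⟫ = 0) (σ : ℝ) (j k : ℕ) :
    ∫ x, Real.exp (σ * ⟪w, x⟫) * ⟪c, x⟫ ^ j * (dirDeriv w)^[k] h x =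
      (-σ) ^ k * ∫ x, Real.exp (σ * ⟪w, x⟫) * ⟪c, x⟫ ^ j * h x := by
  induction k with
  | zero => simp
  | succ k ih =>
    have hck := hc.iterate_dirDeriv w k
    have hsk := hs.iterate_dirDeriv w k
    have hE : ∀ x, HasFDerivAt (fun x : Euc 3 => Real.exp (σ * ⟪w, x⟫) * ⟪c, x⟫ ^ j)
        (fderiv ℝ (fun x : Euc 3 => Real.exp (σ * ⟪w, x⟫) * ⟪c, x⟫ ^ j) x) x := fun x =>
      (((((innerSL ℝ w).differentiable.const_mul σ).exp).mul
        ((innerSL ℝ c).differentiable.pow j)) x).hasFDerivAt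
    have hEc : Continuous fun x : Euc 3 => Real.exp (σ * ⟪w, x⟫) * ⟪c, x⟫ ^ j := by fun_prop
    have hEd : ∀ x, fderiv ℝ (fun x : Euc 3 => Real.exp (σ * ⟪w, x⟫) * ⟪c, x⟫ ^ j) x w
        = σ * (Real.exp (σ * ⟪w, x⟫) * ⟪c, x⟫ ^ j) := by
      intro x
      have hline : HasDerivAt (fun t : ℝ => x + t • w) w 0 := by
        simpa using ((hasDerivAt_id (0 : ℝ)).smul_const w).const_add x
      have h1 := (show HasFDerivAt _ _ (x + (0 : ℝ) • w) from by
        simpa using hE x).comp_hasDerivAt (0 : ℝ) hline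
      have h2 : HasDerivAt (fun t : ℝ => Real.exp (σ * (⟪w, x⟫ + t)) * ⟪c, x⟫ ^ j)
          (Real.exp (σ * (⟪w, x⟫ + 0)) * (σ * 1) * ⟪c, x⟫ ^ j) 0 :=
        ((((hasDerivAt_id (0 : ℝ)).const_add _).const_mul σ).exp).mul_const _
      have h3 : ((fun x : Euc 3 => Real.exp (σ * ⟪w, x⟫) * ⟪c, x⟫ ^ j) ∘ fun t : ℝ => x + t • w)
          = fun t : ℝ => Real.exp (σ * (⟪w, x⟫ + t)) * ⟪c, x⟫ ^ j := by
        funext t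
        simp [inner_add_right, inner_smul_right, hw,
          real_inner_comm w c, hcw]
      rw [h3] at h1
      rw [h1.unique h2]
      simp
      ring
    have hint : ∀ k, Integrable fun x =>
        Real.exp (σ * ⟪w, x⟫) * ⟪c, x⟫ ^ j * (dirDeriv w)^[k] h x := fun k =>
      (hEc.mul (hc.iterate_dirDeriv w k).continuous).integrable_of_hasCompactSupport
        (hs.iterate_dirDeriv w k).mul_left
    rw [Function.iterate_succ_apply']
    have hparts := integral_mul_fderiv_eq_neg_fderiv_mul_of_integrable (μ := volume) (v := w)
      (f := fun x : Euc 3 => Real.exp (σ * ⟪w, x⟫) * ⟪c, x⟫ ^ j) (g := (dirDeriv w)^[k] h)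
      (by simp_rw [hEd, mul_assoc]; simpa only [mul_assoc] using (hint k).const_mul σ)
      (by simpa only [Function.iterate_succ_apply', dirDeriv] using hint (k + 1)) (hint k)
      (fun x _ => (hE x).differentiableAt)
      (fun x _ => (hck.differentiable (by simp)).differentiableAt)
    unfold dirDeriv at hparts ⊢
    rw [hparts]
    simp_rw [hEd, mul_assoc σ]
    rw [integral_const_mul]
    unfold dirDeriv at ih
    rw [ih]
    ring

/-- The moments `∫ ⟨v, x⟩^a e^⟨ζ, x⟩ ⟨f x, v^b ⊗ ζ^(m - b)⟩ dx` of the Laplace transform of `f`. -/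
noncomputable def expMoment (f : Euc 3 → Tensor m (Euc 3)) (v : Euc 3) (a b : ℕ) (ζ : Euc 3) : ℝ :=
  ∫ x, Real.exp ⟪ζ, x⟫ * ⟪v, x⟫ ^ a * f x (mixArg m b v ζ)

/-- The coefficients of the relation between the moments. -/
noncomputable def expCoeff (m l i : ℕ) : ℝ :=
  m.choose i * (m + 1).descFactorial i * (m - i).choose (l - i)

/-- The relations on the planes orthogonal to `w`, after the Laplace transform in the distance of
the plane. -/
lemma sum_expCoeff_mul_expMoment (hf : IsSymmTensorFieldIn m 3 B f) (hB_conn : IsConnected B)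
    (hB : Bornology.IsBounded B) (henc : Encompasses γ B) (h0 : restrictedTransverseRay γ f = 0)
    {w : Euc 3} (hw : ‖w‖ = 1) (hpts : ∀ᵐ p : ℝ, (hyperplane w p ∩ B).Nonempty →
      ∃ g : Fin (m + 1) → Euc 3, Function.Injective g ∧ ∀ j, g j ∈ hyperplane w p ∩ γ)
    {c : Euc 3} (hc : ⟪w, c⟫ = 0) {l : ℕ} (hl : l ≤ m) {σ : ℝ} (hσ : σ ≠ 0) :
    ∑ i ∈ Finset.range (l + 1), expCoeff m l i * expMoment f c (l - i) i (σ • w) = 0 := by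
  obtain ⟨b, rfl⟩ := exists_orthonormalBasis_zero_eq hw
  have h1 : ∫ x, Real.exp (σ * ⟪b 0, x⟫) * momentIntegrand f (b 0) c l x = 0 := by
    refine integral_eq_zero_of_ae_plane b ?_
    filter_upwards [hpts, ae_nonempty_or_dirDeriv_eq_zero hf hB_conn (b 0)] with p hp hor
    simp_rw [inner_basis_zero_planePoint]
    rw [integral_const_mul]
    refine mul_eq_zero_of_right _ ?_
    rcases hor with hne | hzero
    · obtain ⟨g, hg, hgγ⟩ := hp hne
      exact integral_momentIntegrand_eq_zero hf hB henc h0 b hg (fun j => (hgγ j).2)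
        (fun j => (hgγ j).1) hc hl
    · refine integral_eq_zero_of_ae (Filter.Eventually.of_forall fun y => ?_)
      exact momentIntegrand_eq_zero (hzero _ (inner_basis_zero_planePoint b p y))
  have hterm : ∀ i, Integrable fun x => Real.exp (σ * ⟪b 0, x⟫) * ⟪c, x⟫ ^ (l - i) *
      (dirDeriv (b 0))^[m + 1 - i] (fun x => f x (mixArg m i c (b 0))) x := fun i =>
    Continuous.integrable_of_hasCompactSupport
      ((by fun_prop : Continuous fun x : Euc 3 => Real.exp (σ * ⟪b 0, x⟫) * ⟪c, x⟫ ^ (l - i)).mul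
        ((hf.contDiff_apply _).iterate_dirDeriv _ _).continuous)
      ((hf.hasCompactSupport_apply hB _).iterate_dirDeriv _ _).mul_left
  have h2 : ∑ i ∈ Finset.range (l + 1), momentCoeff m l i * ((-σ) ^ (m + 1 - i) *
      ∫ x, Real.exp (σ * ⟪b 0, x⟫) * ⟪c, x⟫ ^ (l - i) * f x (mixArg m i c (b 0))) = 0 := by
    refine Eq.trans ?_ h1
    simp_rw [← integral_exp_mul_iterate_dirDeriv (hf.contDiff_apply _)
      (hf.hasCompactSupport_apply hB _) hw hc, ← integral_const_mul]
    rw [← integral_finsetSum _ fun i _ => (hterm i).const_mul _]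
    congr 1
    funext x
    rw [momentIntegrand, Finset.mul_sum]
    refine Finset.sum_congr rfl fun i _ => ?_
    rw [iterate_dirDeriv_apply hf.smooth]
    ring
  have h3 : ((-1) ^ (m + 1) * σ) * ∑ i ∈ Finset.range (l + 1),
      expCoeff m l i * expMoment f c (l - i) i (σ • b 0) = 0 := by
    refine Eq.trans ?_ h2
    rw [Finset.mul_sum]
    refine Finset.sum_congr rfl fun i hi => ?_
    have him : i ≤ m := by have := Finset.mem_range.1 hi; omega
    have h4 : expMoment f c (l - i) i (σ • b 0) = σ ^ (m - i) *
        ∫ x, Real.exp (σ * ⟪b 0, x⟫) * ⟪c, x⟫ ^ (l - i) * f x (mixArg m i c (b 0)) := by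
      rw [expMoment, ← integral_const_mul]
      congr 1
      funext x
      rw [mixArg_smul_right _ him, real_inner_smul_left]
      ring
    have h5 : (-1 : ℝ) ^ (m + 1) = (-1) ^ i * (-1) ^ (m + 1 - i) := by
      rw [← pow_add]; congr 1; omega
    rw [h4, expCoeff, momentCoeff, jetCoeff, neg_pow σ, h5,
      show m + 1 - i = m - i + 1 by omega]
    ring
  exact (mul_eq_zero.1 h3).resolve_left (mul_ne_zero (pow_ne_zero _ (by norm_num)) hσ)

end Laplace

/-! ### A nonvanishing combination of binomial coefficients -/

section Coefficients

lemma sum_choose_div_pos {l m : ℕ} (hl : l ≤ m) :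
    0 < ∑ i ∈ Finset.range (l + 1), (-1 : ℝ) ^ (l - i) * l.choose i / (m + 1 - i : ℕ) := by
  -- the sum is the integral of `u ^ (m - l) * (1 - u) ^ l` over the unit interval
  have h1 : ∫ u in (0 : ℝ)..1, u ^ (m - l) * (1 - u) ^ l
      = ∑ i ∈ Finset.range (l + 1), (-1 : ℝ) ^ (l - i) * l.choose i / (m + 1 - i : ℕ) := by
    have h2 : ∀ u : ℝ, u ^ (m - l) * (1 - u) ^ l
        = ∑ i ∈ Finset.range (l + 1), ((-1 : ℝ) ^ (l - i) * l.choose i) * u ^ (m - i) := by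
      intro u
      rw [sub_eq_add_neg, add_pow, Finset.mul_sum]
      refine Finset.sum_congr rfl fun i hi => ?_
      have := Finset.mem_range.1 hi
      rw [neg_pow u, one_pow, show m - i = (m - l) + (l - i) by omega, pow_add]
      ring
    simp_rw [h2]
    rw [intervalIntegral.integral_finsetSum fun i _ =>
      (by fun_prop : Continuous fun u : ℝ => ((-1 : ℝ) ^ (l - i) * l.choose i) * u ^ (m - i)
        ).intervalIntegrable _ _]
    refine Finset.sum_congr rfl fun i hi => ?_
    have := Finset.mem_range.1 hi
    rw [intervalIntegral.integral_const_mul, integral_pow, show m + 1 - i = m - i + 1 by omega]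
    simp
    ring
  rw [← h1]
  refine intervalIntegral.intervalIntegral_pos_of_pos_on
    ((by fun_prop : Continuous fun u : ℝ => u ^ (m - l) * (1 - u) ^ l).intervalIntegrable _ _)
    (fun u hu => ?_) one_pos
  exact mul_pos (pow_pos hu.1 _) (pow_pos (by linarith [hu.2]) _)

lemma sum_expCoeff_ne_zero {l m : ℕ} (hl : l ≤ m) :
    ∑ i ∈ Finset.range (l + 1), expCoeff m l i *
      ((-1) ^ (l - i) * (m - i).descFactorial (l - i)) ≠ 0 := by
  have h1 : ∀ i ∈ Finset.range (l + 1), expCoeff m l i *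
      ((-1) ^ (l - i) * (m - i).descFactorial (l - i))
      = (m.choose l * (m + 1).descFactorial (l + 1)) *
        ((-1 : ℝ) ^ (l - i) * l.choose i / (m + 1 - i : ℕ)) := by
    intro i hi
    have hil : i ≤ l := Nat.lt_succ_iff.1 (Finset.mem_range.1 hi)
    have hpos : ((m + 1 - i : ℕ) : ℝ) ≠ 0 := by
      rw [Nat.cast_ne_zero]; omega
    have hd : ((m + 1).descFactorial (l + 1) : ℝ)
        = (m + 1).descFactorial i * ((m + 1 - i : ℕ) * (m - i).descFactorial (l - i)) := by
      have h3 := Nat.descFactorial_mul_descFactorial (n := m + 1) (show i ≤ l + 1 by omega)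
      have h4 := Nat.succ_descFactorial_succ (m - i) (l - i)
      rw [← h3, show m + 1 - i = (m - i) + 1 by omega, show l + 1 - i = (l - i) + 1 by omega]
      push_cast [h4]
      ring
    have hc : (m.choose l * l.choose i : ℝ) = m.choose i * (m - i).choose (l - i) := by
      exact_mod_cast Nat.choose_mul hil
    rw [expCoeff, hd]
    field_simp
    linear_combination (-((m + 1).descFactorial i * (m - i).descFactorial (l - i) : ℝ)) * hc
  rw [Finset.sum_congr rfl h1, ← Finset.mul_sum]
  refine mul_ne_zero (mul_ne_zero ?_ ?_) (sum_choose_div_pos hl).ne'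
  · exact_mod_cast (Nat.choose_pos hl).ne'
  · rw [Nat.cast_ne_zero, Ne, Nat.descFactorial_eq_zero_iff_lt]
    omega

end Coefficients

/-! ### The moments of the Laplace transform vanish -/

section Moments

variable {m : ℕ} {B γ : Set (Euc 3)} {f : Euc 3 → Tensor m (Euc 3)}

lemma IsSymmTensorFieldIn.continuous_expMoment_integrand {X : Type*} [TopologicalSpace X]
    (hf : IsSymmTensorFieldIn m 3 B f) (v : Euc 3) (a b : ℕ) {u z : X → Euc 3} (hu : Continuous u)
    (hz : Continuous z) :
    Continuous fun q => Real.exp ⟪z q, u q⟫ * ⟪v, u q⟫ ^ a * f (u q) (mixArg m b v (z q)) := by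
  refine Continuous.mul (by fun_prop) ?_
  exact (hf.smooth.continuous.comp hu).eval (continuous_mixArg continuous_const hz b)

lemma IsSymmTensorFieldIn.hasDerivAt_expMoment (hf : IsSymmTensorFieldIn m 3 B f)
    (hB : Bornology.IsBounded B) (v ζ : Euc 3) (a : ℕ) {b : ℕ} (hb : b ≤ m) :
    HasDerivAt (fun s : ℝ => expMoment f v a b (ζ + s • v))
      (expMoment f v (a + 1) b ζ + (m - b : ℕ) * expMoment f v a (b + 1) ζ) 0 := by
  have hz : Continuous fun q : ℝ × Euc 3 => ζ + q.1 • v := by fun_prop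
  have hd := hasDerivAt_integral_of_isCompact (μ := (volume : Measure (Euc 3)))
    (F := fun s x => Real.exp ⟪ζ + s • v, x⟫ * ⟪v, x⟫ ^ a * f x (mixArg m b v (ζ + s • v)))
    (F' := fun s x =>
      Real.exp ⟪ζ + s • v, x⟫ * ⟪v, x⟫ ^ (a + 1) * f x (mixArg m b v (ζ + s • v)) +
      (m - b : ℕ) *
        (Real.exp ⟪ζ + s • v, x⟫ * ⟪v, x⟫ ^ a * f x (mixArg m (b + 1) v (ζ + s • v))))
    (hf.continuous_expMoment_integrand v a b continuous_snd hz)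
    ((hf.continuous_expMoment_integrand v (a + 1) b continuous_snd hz).add
      (continuous_const.mul (hf.continuous_expMoment_integrand v a (b + 1) continuous_snd hz)))
    (fun s x => ?_) (hf.hasCompactSupport hB).isCompact (fun s x hx => ?_) 0
  · refine hd.congr_deriv ?_
    have hint : ∀ a b, Integrable fun x =>
        Real.exp ⟪ζ, x⟫ * ⟪v, x⟫ ^ a * f x (mixArg m b v ζ) := fun a b =>
      (hf.continuous_expMoment_integrand v a b continuous_id
        continuous_const).integrable_of_hasCompactSupport
        (hf.hasCompactSupport_apply hB _).mul_left
    simp only [zero_smul, add_zero]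
    rw [integral_add (hint _ _) ((hint _ _).const_mul _), integral_const_mul]
    rfl
  · have h1 : HasDerivAt (fun s : ℝ => Real.exp ⟪ζ + s • v, x⟫)
        (Real.exp ⟪ζ + s • v, x⟫ * ⟪v, x⟫) s := by
      have h2 : HasDerivAt (fun s : ℝ => ⟪ζ, x⟫ + s * ⟪v, x⟫) ⟪v, x⟫ s := by
        simpa using ((hasDerivAt_id s).mul_const ⟪v, x⟫).const_add ⟪ζ, x⟫
      simp_rw [inner_add_left, real_inner_smul_left]
      exact h2.exp
    refine ((h1.mul_const (⟪v, x⟫ ^ a)).mul ((hf.symm x).hasDerivAt_mixArg hb v ζ s)).congr_deriv ?_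
    ring
  · rw [image_eq_zero_of_notMem_tsupport hx]
    simp

/-- Expansion of `T ((c + κ ζ)^l ζ^(m - l))` in the values `T (c^j ζ^(m - j))`, `j ≤ l`. -/
lemma IsSymmTensor.apply_mixArg_add {T : Tensor m (Euc 3)} (hT : IsSymmTensor T) (l : ℕ) (κ : ℝ)
    (c ζ : Euc 3) : T (mixArg m l (c + κ • ζ) ζ) = ∑ s : Finset (Fin m),
      (∏ k, if k ∈ s then (1 : ℝ) else if (k : ℕ) < l then κ else 0) *
        T (mixArg m (s.filter fun k : Fin m => (k : ℕ) < l).card c ζ) := by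
  have h1 : mixArg m l (c + κ • ζ) ζ = (fun k : Fin m => if (k : ℕ) < l then c else ζ) +
      fun k : Fin m => (if (k : ℕ) < l then κ else 0) • ζ := by
    funext k
    by_cases hk : (k : ℕ) < l <;> simp [mixArg, hk]
  rw [h1, T.map_add_univ]
  refine Finset.sum_congr rfl fun s _ => ?_
  have h2 : s.piecewise (fun k : Fin m => if (k : ℕ) < l then c else ζ)
      (fun k : Fin m => (if (k : ℕ) < l then κ else 0) • ζ) = fun k : Fin m =>
        (if k ∈ s then (1 : ℝ) else if (k : ℕ) < l then κ else 0) •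
          (if k ∈ s.filter fun k : Fin m => (k : ℕ) < l then c else ζ) := by
    funext k
    by_cases hk : k ∈ s <;> simp [hk]
  rw [h2, T.map_smul_univ, hT.apply_ite, smul_eq_mul]

/-- All moments of order at most `m` vanish. In the induction on the order `l = a + b`, the
derivative of a moment of order `l - 1` expresses all moments of order `l` by the one with `a = 0`,
and the relation on the planes orthogonal to `ζ` makes this one vanish. -/
lemma expMoment_eq_zero (hf : IsSymmTensorFieldIn m 3 B f) (hB_conn : IsConnected B)
    (hB : Bornology.IsBounded B) (henc : Encompasses γ B) (h0 : restrictedTransverseRay γ f = 0)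
    (hpts : ∀ᵐ w : sphere (0 : Euc 3) 1 ∂(volume : Measure (Euc 3)).toSphere, ∀ᵐ p : ℝ,
      (hyperplane (w : Euc 3) p ∩ B).Nonempty → ∃ g : Fin (m + 1) → Euc 3,
        Function.Injective g ∧ ∀ j, g j ∈ hyperplane (w : Euc 3) p ∩ γ) :
    ∀ l ≤ m, ∀ v ζ : Euc 3, ∀ a b : ℕ, a + b = l → expMoment f v a b ζ = 0 := by
  intro l
  induction l using Nat.strong_induction_on with
  | _ l ih =>
  intro hl
  have hstep : ∀ (v ζ : Euc 3) (a b : ℕ), a + 1 + b = l →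
      expMoment f v (a + 1) b ζ = -((m - b : ℕ) * expMoment f v a (b + 1) ζ) := by
    intro v ζ a b hab
    have h1 := hf.hasDerivAt_expMoment hB v ζ a (show b ≤ m by omega)
    have h2 : (fun s : ℝ => expMoment f v a b (ζ + s • v)) = fun _ => 0 :=
      funext fun s => ih (a + b) (by omega) (by omega) v _ a b rfl
    rw [h2] at h1
    exact eq_neg_of_add_eq_zero_left (h1.unique (hasDerivAt_const _ _))
  have hred : ∀ (v ζ : Euc 3) (a : ℕ), a ≤ l → expMoment f v a (l - a) ζ =
      ((-1) ^ a * (m - (l - a)).descFactorial a) * expMoment f v 0 l ζ := by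
    intro v ζ a
    induction a with
    | zero => simp
    | succ a iha =>
      intro ha
      rw [hstep v ζ a (l - (a + 1)) (by omega), show l - (a + 1) + 1 = l - a by omega,
        iha (by omega), show m - (l - (a + 1)) = m - (l - a) + 1 by omega,
        Nat.succ_descFactorial_succ]
      push_cast
      ring
  have horth : ∀ᵐ w : sphere (0 : Euc 3) 1 ∂(volume : Measure (Euc 3)).toSphere,
      ∀ σ : ℝ, σ ≠ 0 → ∀ c : Euc 3, ⟪(w : Euc 3), c⟫ = 0 →
        expMoment f c 0 l (σ • (w : Euc 3)) = 0 := by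
    filter_upwards [hpts] with w hw σ hσ c hc
    have h1 := sum_expCoeff_mul_expMoment hf hB_conn hB henc h0 (by simp) hw hc hl hσ
    have h2 : (∑ i ∈ Finset.range (l + 1), expCoeff m l i *
        ((-1) ^ (l - i) * (m - i).descFactorial (l - i))) *
          expMoment f c 0 l (σ • (w : Euc 3)) = 0 := by
      rw [← h1, Finset.sum_mul]
      refine Finset.sum_congr rfl fun i hi => ?_
      have hil : i ≤ l := Nat.lt_succ_iff.1 (Finset.mem_range.1 hi)
      have h3 := hred c (σ • (w : Euc 3)) (l - i) (Nat.sub_le _ _)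
      rw [Nat.sub_sub_self hil] at h3
      rw [h3]
      ring
    exact (mul_eq_zero.1 h2).resolve_left (sum_expCoeff_ne_zero hl)
  -- components of `v` along `ζ` only contribute moments of lower order
  have hall : ∀ᵐ w : sphere (0 : Euc 3) 1 ∂(volume : Measure (Euc 3)).toSphere,
      ∀ σ : ℝ, σ ≠ 0 → ∀ v : Euc 3, expMoment f v 0 l (σ • (w : Euc 3)) = 0 := by
    filter_upwards [horth] with w hw σ hσ v
    set ζ := σ • (w : Euc 3) with hζ
    set κ := σ⁻¹ * ⟪(w : Euc 3), v⟫ with hκ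
    set c := v - κ • ζ with hc
    have hcw : ⟪(w : Euc 3), c⟫ = 0 := by
      rw [hc, hζ, hκ, inner_sub_right, inner_smul_right, inner_smul_right,
        real_inner_self_eq_norm_sq, norm_eq_of_mem_sphere]
      field_simp
      ring
    have hv : v = c + κ • ζ := by rw [hc]; abel
    have hzero : ∀ j ≤ l, expMoment f c 0 j ζ = 0 := by
      intro j hj
      rcases hj.lt_or_eq with hlt | rfl
      · exact ih j hlt (by omega) c ζ 0 j (zero_add j)
      · exact hw σ hσ c hcw
    rw [hv, expMoment]
    simp_rw [(hf.symm _).apply_mixArg_add, Finset.mul_sum]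
    rw [integral_finsetSum]
    · refine Finset.sum_eq_zero fun s _ => ?_
      have hcard : (s.filter fun k : Fin m => (k : ℕ) < l).card ≤ l := by
        refine (Finset.card_le_card (Finset.filter_subset_filter _ s.subset_univ)).trans ?_
        rw [Fin.card_filter_val_lt]
        exact min_le_right _ _
      refine Eq.trans ?_ (mul_eq_zero_of_right
        (∏ k : Fin m, if k ∈ s then (1 : ℝ) else if (k : ℕ) < l then κ else 0) (hzero _ hcard))
      rw [expMoment, ← integral_const_mul]
      congr 1
      funext x
      simp only [pow_zero]
      ring
    · intro s _
      refine Continuous.integrable_of_hasCompactSupport ?_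
        (hf.hasCompactSupport_apply hB _).mul_left.mul_left
      have := (hf.contDiff_apply
        (mixArg m (s.filter fun k : Fin m => (k : ℕ) < l).card c ζ)).continuous
      fun_prop
  -- the remaining `ζ` are limits of these
  have hcont : ∀ v : Euc 3, Continuous fun ζ => expMoment f v 0 l ζ := by
    intro v
    have h1 : ∀ ζ, expMoment f v 0 l ζ
        = ∫ x in tsupport f, Real.exp ⟪ζ, x⟫ * ⟪v, x⟫ ^ 0 * f x (mixArg m l v ζ) := by
      intro ζ
      refine (setIntegral_eq_integral_of_forall_compl_eq_zero fun x hx => ?_).symm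
      rw [image_eq_zero_of_notMem_tsupport hx]
      simp
    simp_rw [h1]
    exact continuous_parametric_integral_of_continuous
      (hf.continuous_expMoment_integrand v 0 l continuous_snd continuous_fst)
      (hf.hasCompactSupport hB).isCompact
  have hsphere : ∀ (v : Euc 3) (σ : ℝ), σ ≠ 0 → ∀ w : sphere (0 : Euc 3) 1,
      expMoment f v 0 l (σ • (w : Euc 3)) = 0 := by
    intro v σ hσ w
    refine congrFun (Continuous.ext_on (Measure.dense_of_ae hall)
      ((hcont v).comp (by fun_prop : Continuous fun w : sphere (0 : Euc 3) 1 => σ • (w : Euc 3)))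
      (continuous_const (y := (0 : ℝ))) fun w hw => hw σ hσ v) w
  have hdiag : ∀ v ζ : Euc 3, expMoment f v 0 l ζ = 0 := by
    intro v ζ
    have hdense : Dense ({0}ᶜ : Set (Euc 3)) := dense_compl_singleton 0
    refine congrFun (Continuous.ext_on hdense (hcont v) (continuous_const (y := (0 : ℝ)))
      fun ζ hζ => ?_) ζ
    have hn : ‖ζ‖ ≠ 0 := norm_ne_zero_iff.2 hζ
    have h1 := hsphere v ‖ζ‖ hn ⟨‖ζ‖⁻¹ • ζ, by simp [norm_smul, hn]⟩
    simpa [smul_smul, hn] using h1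
  intro v ζ a b hab
  obtain rfl : b = l - a := by omega
  rw [hred v ζ a (by omega), hdiag, mul_zero]

end Moments

/-! ### Injectivity of the Laplace transform -/

section LaplaceInjective

/-- A continuous compactly supported function whose Laplace transform vanishes is zero, because
exponentials span a dense subalgebra. -/
lemma eq_zero_of_integral_exp_mul_eq_zero {h : Euc 3 → ℝ} (hc : Continuous h)
    (hs : HasCompactSupport h) (h0 : ∀ ζ : Euc 3, ∫ x, Real.exp ⟪ζ, x⟫ * h x = 0) : h = 0 := by
  let E : Multiplicative (Euc 3) →* C(Euc 3, ℝ) :=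
    { toFun := fun ζ => ⟨fun x => Real.exp ⟪ζ.toAdd, x⟫, by fun_prop⟩
      map_one' := by ext x; simp
      map_mul' := fun ζ η => by
        ext x
        simp [inner_add_left, Real.exp_add] }
  let A : Subalgebra ℝ C(Euc 3, ℝ) := Algebra.adjoin ℝ (MonoidHom.mrange E : Set C(Euc 3, ℝ))
  have hsep : A.SeparatesPoints := by
    intro x y hxy
    refine ⟨_, ⟨E (Multiplicative.ofAdd (x - y)),
      Algebra.subset_adjoin ⟨Multiplicative.ofAdd (x - y), rfl⟩, rfl⟩, fun heq => ?_⟩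
    have h1 : ⟪x - y, x⟫ = ⟪x - y, y⟫ := Real.exp_injective heq
    rw [← sub_eq_zero, ← inner_sub_right, inner_self_eq_zero, sub_eq_zero] at h1
    exact hxy h1
  have hint : ∀ g : C(Euc 3, ℝ), Integrable fun x => g x * h x := fun g =>
    (g.continuous.mul hc).integrable_of_hasCompactSupport hs.mul_left
  have hA : ∀ g ∈ A, ∫ x, g x * h x = 0 := by
    intro g hg
    rw [← Subalgebra.mem_toSubmodule, Algebra.adjoin_eq_span, Submonoid.closure_eq] at hg
    induction hg using Submodule.span_induction with
    | mem g hg =>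
      obtain ⟨ζ, rfl⟩ := hg
      exact h0 ζ.toAdd
    | zero => simp
    | add g₁ g₂ _ _ h₁ h₂ =>
      simp only [ContinuousMap.add_apply, add_mul]
      rw [integral_add (hint g₁) (hint g₂), h₁, h₂, add_zero]
    | smul r g _ h₁ =>
      simp only [ContinuousMap.smul_apply, smul_eq_mul, mul_assoc]
      rw [integral_const_mul, h₁, mul_zero]
  have hhi : Integrable h := hc.integrable_of_hasCompactSupport hs
  have hsq : ∀ ε > 0, ∫ x, h x * h x ≤ ε * ∫ x, |h x| := by
    intro ε hε
    obtain ⟨g, hgA, hg⟩ :=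
      ContinuousMap.exists_mem_subalgebra_near_continuous_of_isCompact_of_separatesPoints hsep
        ⟨h, hc⟩ hs.isCompact hε
    have h1 : ∫ x, h x * h x = ∫ x, (h x * h x - g x * h x) := by
      have h2 := integral_sub (hint ⟨h, hc⟩) (hint g)
      rw [hA g hgA, sub_zero] at h2
      exact h2.symm
    rw [h1, ← integral_const_mul]
    refine integral_mono ((hint ⟨h, hc⟩).sub (hint g)) (hhi.abs.const_mul ε) fun x => ?_
    by_cases hx : x ∈ tsupport h
    · have h2 := (hg x hx).le
      rw [Real.norm_eq_abs, abs_sub_comm] at h2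
      calc h x * h x - g x * h x ≤ |(h x - g x) * h x| := by
            rw [← sub_mul]; exact le_abs_self _
        _ ≤ ε * |h x| := by
            rw [abs_mul]; exact mul_le_mul_of_nonneg_right h2 (abs_nonneg _)
    · simp [image_eq_zero_of_notMem_tsupport hx]
  have hle : ∫ x, h x * h x ≤ 0 := by
    refine le_of_forall_pos_le_add fun δ hδ => ?_
    have hI : 0 ≤ ∫ x, |h x| := integral_nonneg fun x => abs_nonneg _
    have hI1 : 0 < (∫ x, |h x|) + 1 := by linarith
    refine (hsq (δ / ((∫ x, |h x|) + 1)) (div_pos hδ hI1)).trans ?_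
    rw [zero_add, div_mul_eq_mul_div, div_le_iff₀ hI1]
    nlinarith
  have hz : ∫ x, h x * h x = 0 := le_antisymm hle (integral_nonneg fun x => mul_self_nonneg _)
  have h3 := (integral_eq_zero_iff_of_nonneg (fun x => mul_self_nonneg (h x))
    (hint ⟨h, hc⟩)).1 hz
  have h4 := (Continuous.ae_eq_iff_eq volume (hc.mul hc) continuous_zero).1 h3
  funext x
  exact mul_self_eq_zero.1 (congrFun h4 x)

end LaplaceInjective

/-! ### Uniqueness and linear reconstruction -/

section Reconstruction

variable {m : ℕ} {B γ : Set (Euc 3)} {f : Euc 3 → Tensor m (Euc 3)}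

/-- A field with vanishing restricted data vanishes. -/
lemma eq_zero_of_restrictedTransverseRay_eq_zero (hf : IsSymmTensorFieldIn m 3 B f)
    (hB_open : IsOpen B) (hB_conn : IsConnected B) (hB : Bornology.IsBounded B)
    (hKT : KirillovTuy m 3 B γ) (henc : Encompasses γ B)
    (h0 : restrictedTransverseRay γ f = 0) : f = 0 := by
  have hmom := expMoment_eq_zero hf hB_conn hB henc h0 (hKT.ae_exists_injective hB_open) m le_rfl
  have hv : ∀ v : Euc 3, (fun x => f x fun _ => v) = 0 := by
    intro v
    refine eq_zero_of_integral_exp_mul_eq_zero (hf.contDiff_apply _).continuous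
      (hf.hasCompactSupport_apply hB _) fun ζ => ?_
    have h1 := hmom v ζ 0 m (zero_add m)
    simpa [expMoment, mixArg_of_le le_rfl] using h1
  funext x
  exact (hf.symm x).eq_zero_of_diagonal fun v => congrFun (hv v) x

/-- The space of smooth symmetric `m`-tensor fields supported in `B`. -/
def symmTensorFieldsIn (m : ℕ) (B : Set (Euc 3)) : Submodule ℝ (Euc 3 → Tensor m (Euc 3)) where
  carrier := {f | IsSymmTensorFieldIn m 3 B f}
  zero_mem' := ⟨fun _ _ _ => rfl, contDiff_const, fun _ _ => rfl⟩
  add_mem' := fun {f g} hf hg =>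
    ⟨fun x σ v => by
      simp only [Pi.add_apply, _root_.add_apply]
      rw [hf.symm x σ v, hg.symm x σ v], hf.smooth.add hg.smooth,
      fun x hx => by rw [Pi.add_apply, hf.supp x hx, hg.supp x hx, add_zero]⟩
  smul_mem' := fun r f hf =>
    ⟨fun x σ v => by
      simp only [Pi.smul_apply, _root_.smul_apply]
      rw [hf.symm x σ v], hf.smooth.const_smul r,
      fun x hx => by rw [Pi.smul_apply, hf.supp x hx, smul_zero]⟩

/-- The restricted transverse ray transform as a linear map; additivity rests on the integrability
along lines, which compact support provides. -/
noncomputable def restrictedTransverseRayLinear (m : ℕ) {B : Set (Euc 3)}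
    (hB : Bornology.IsBounded B) (γ : Set (Euc 3)) :
    symmTensorFieldsIn m B →ₗ[ℝ] LineThrough γ → Fin (m + 1) → ℝ where
  toFun f := restrictedTransverseRay γ (f : Euc 3 → Tensor m (Euc 3))
  map_add' := by
    rintro ⟨f, hf⟩ ⟨g, hg⟩
    replace hf : IsSymmTensorFieldIn m 3 B f := hf
    replace hg : IsSymmTensorFieldIn m 3 B g := hg
    funext l i
    have hl : l.1.2 ≠ 0 := by
      intro h
      have := l.2.1
      simp [h] at this
    simp only [restrictedTransverseRay, transverseRay, Pi.add_apply]
    have hsum : IsSymmTensorFieldIn m 3 B (f + g) := (symmTensorFieldsIn m B).add_mem hf hg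
    rw [← integral_add]
    · congr 1
      funext t
      rw [symPairing_of_isSymmTensor (hf.symm _), symPairing_of_isSymmTensor (hg.symm _)]
      exact symPairing_of_isSymmTensor (hsum.symm _) _
    · simp_rw [symPairing_of_isSymmTensor (hf.symm _)]
      exact integrable_line (hf.contDiff_apply _).continuous (hf.hasCompactSupport_apply hB _) _ hl
    · simp_rw [symPairing_of_isSymmTensor (hg.symm _)]
      exact integrable_line (hg.contDiff_apply _).continuous (hg.hasCompactSupport_apply hB _) _ hl
  map_smul' := by
    rintro r ⟨f, hf⟩
    replace hf : IsSymmTensorFieldIn m 3 B f := hf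
    have hr : IsSymmTensorFieldIn m 3 B (r • f) := (symmTensorFieldsIn m B).smul_mem r hf
    funext l i
    simp only [restrictedTransverseRay, transverseRay, Pi.smul_apply, RingHom.id_apply, smul_eq_mul]
    rw [← integral_const_mul]
    congr 1
    funext t
    rw [symPairing_of_isSymmTensor (hf.symm _)]
    exact symPairing_of_isSymmTensor (hr.symm _) _

end Reconstruction

theorem theorem2p1 (m : ℕ) (B γ : Set (Euc 3))
    (hB_open : IsOpen B) (hB_conn : IsConnected B) (hB_bdd : Bornology.IsBounded B)
    (hKT : KirillovTuy m 3 B γ) (henc : Encompasses γ B) :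
    (∀ f g : Euc 3 → Tensor m (Euc 3),
      IsSymmTensorFieldIn m 3 B f → IsSymmTensorFieldIn m 3 B g →
      restrictedTransverseRay γ f = restrictedTransverseRay γ g → f = g) ∧
    ∃ Rec : (LineThrough γ → Fin (m + 1) → ℝ) →ₗ[ℝ] (Euc 3 → Tensor m (Euc 3)),
      ∀ f : Euc 3 → Tensor m (Euc 3), IsSymmTensorFieldIn m 3 B f →
        Rec (restrictedTransverseRay γ f) = f := by
  set D := restrictedTransverseRayLinear m hB_bdd γ
  have hker : LinearMap.ker D = ⊥ := by
    rw [LinearMap.ker_eq_bot']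
    rintro ⟨f, hf⟩ h0
    exact Subtype.ext (eq_zero_of_restrictedTransverseRay_eq_zero hf hB_open hB_conn hB_bdd hKT
      henc h0)
  refine ⟨fun f g hf hg hfg => ?_, ?_⟩
  · have h : D ⟨f, hf⟩ = D ⟨g, hg⟩ := hfg
    have hinj : Function.Injective D := (LinearMap.ker_eq_bot (M := symmTensorFieldsIn m B)
      (M₂ := LineThrough γ → Fin (m + 1) → ℝ) (f := D)).1 hker
    exact congrArg Subtype.val (hinj h)
  · obtain ⟨L, hL⟩ := LinearMap.exists_leftInverse_of_injective (V := symmTensorFieldsIn m B)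
      (V' := LineThrough γ → Fin (m + 1) → ℝ) D hker
    refine ⟨(symmTensorFieldsIn m B).subtype ∘ₗ L, fun f hf => ?_⟩
    exact congrArg Subtype.val (LinearMap.congr_fun hL ⟨f, hf⟩)
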